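/- Let $\Bbbk$ be a commutative ring, $t\in\Bbbk$, and $k,l\in\mathbb N$ (zero included). A *partition of type $\binom lk$* is a set partition of $k$ bottom vertices $1,\dots,k$ and $l$ top vertices $1',\dots,l'$, each row ordered from left to right. It is *planar* if it can be drawn without crossings in the rectangle spanned by its vertices, i.e. if there are no vertices $a,b,c,d$ occurring in this order along $1,\dots,k,l',\dots,1'$ with $a,c$ in one block and $b,d$ in another. A *Motzkin diagram* is a planar partition all of whose blocks have at most two elements. In the *partition category* $\mathcal{P}ar(t)$ the objects are the natural numbers, $\operatorname{Hom}(k,l)$ is the free $\Bbbk$-module on the partitions of type $\binom lk$, composition is bilinear with $D\circ D'=t^{\alpha(D,D')}\,D\star D'$, where $D\star D'$ is obtained by stacking $D$ on top of $D'$ and $\alpha(D,D')$ is the number of connected components of the stack lying entirely in the middle row, and $\otimes$ is horizontal juxtaposition. The *partition algebra* is $P_k(t)=\operatorname{End}_{\mathcal{P}ar(t)}(k)$; the *Motzkin algebra* $M_k(t)$ is the $\Bbbk$-span of the Motzkin diagrams of type $\binom kk$ in $P_k(t)$. The *Motzkin category* $\mathcal M(t)$ is the strict $\Bbbk$-linear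 monoidal category with one generating object $1$ (so that its objects are $0,1,2,\dots$, with tensor product $+$), generating morphisms $d\colon 2\to 0$, $c\colon 0\to 2$, $\eta\colon 0\to 1$, $\varepsilon\colon 1\to 0$, and relations $$d\circ(1_1\otimes\eta)=\varepsilon=d\circ(\eta\otimes 1_1),\qquad (1_1\otimes\varepsilon)\circ c=\eta=(\varepsilon\otimes 1_1)\circ c,$$ $$(d\otimes 1_1)\circ(1_1\otimes c)=1_1=(1_1\otimes d)\circ(c\otimes 1_1),\qquad d\circ c=t\,1_0=\varepsilon\circ\eta .$$ Then there is a strict $\Bbbk$-linear monoidal functor $J\colon\mathcal M(t)\to\mathcal{P}ar(t)$ which is the identity on objects and sends each of $d,c,\eta,\varepsilon$ to the one-block partition of its type, such that the following hold. 1. For all $k,l$, the $\Bbbk$-module $\operatorname{Hom}_{\mathcal M(t)}(k,l)$ has a basis $(b_D)$ indexed by the Motzkin diagrams $D$ of type $\binom lk$, in which $b_D$ is built from the generators and identities by compositions and tensor products alone, and $J(b_D)=D$. 2. For all $k$, the span $M_k(t)$ of the Motzkin diagrams is a subalgebra of $P_k(t)$, and $J$ restricts to an isomorphism of $\Bbbk$-algebras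 $\operatorname{End}_{\mathcal M(t)}(k)\cong M_k(t)$. -/

import Mathlib

open CategoryTheory

universe u

namespace MotzkinCat

/-! ### Partition diagrams -/

/-- A partition of type `(l over k)`: a set partition, given by its equivalence relation, of the
`k` bottom vertices (`Sum.inl i`) and the `l` top vertices (`Sum.inr j`), both rows numbered from
left to right. As a morphism it goes from `k` to `l`. -/
abbrev Partition (k l : ℕ) : Type := Setoid (Fin k ⊕ Fin l)

/-- The position of a vertex on the boundary of the rectangle, walking along the bottom row from
left to right and then along the top row from right to left. -/
def boundaryPos {k l : ℕ} : Fin k ⊕ Fin l → ℕ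
  | Sum.inl i => i
  | Sum.inr j => k + (Fin.rev j : ℕ)

/-- A partition is planar if its blocks can be drawn in the rectangle without crossings:
there are no four boundary vertices `a, b, c, d`, in this order, with `a, c` in one block and
`b, d` in another block. -/
def IsPlanar {k l : ℕ} (p : Partition k l) : Prop :=
  ∀ a b c d : Fin k ⊕ Fin l,
    boundaryPos a < boundaryPos b → boundaryPos b < boundaryPos c →
    boundaryPos c < boundaryPos d → p a c → p b d → p a b

/-- Rook-Brauer diagrams: all blocks have size at most two. -/
def IsRookBrauer {k l : ℕ} (p : Partition k l) : Prop :=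
  ∀ B ∈ p.classes, B.ncard ≤ 2

/-- Motzkin diagrams of type `(l over k)`: planar rook-Brauer diagrams. -/
def MotzkinDiagram (k l : ℕ) : Type :=
  {p : Partition k l // IsRookBrauer p ∧ IsPlanar p}

/-! ### Stacking partitions -/

section Stack

variable {V X Y : Type}

/-- The equivalence relation on `V` generated by a copy of `r` (placed by `f`) and a copy of `s`
(placed by `g`). -/
def glue (f : X → V) (r : Setoid X) (g : Y → V) (s : Setoid Y) : Setoid V :=
  Relation.EqvGen.setoid fun x y =>
    (∃ a b, r a b ∧ f a = x ∧ f b = y) ∨ (∃ a b, s a b ∧ g a = x ∧ g b = y)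

variable {A B C : Type}

/-- Connectivity of the three-row diagram (rows `A`, `B`, `C` from bottom to top) obtained by
stacking `p` on top of `q`. -/
def stack (p : Setoid (B ⊕ C)) (q : Setoid (A ⊕ B)) : Setoid (A ⊕ B ⊕ C) :=
  glue (Sum.map id Sum.inl) q Sum.inr p

/-- The partition `p ⋆ q` induced on the bottom and top rows by stacking `p` on top of `q`. -/
def star (p : Setoid (B ⊕ C)) (q : Setoid (A ⊕ B)) : Setoid (A ⊕ C) :=
  (stack p q).comap (Sum.map id Sum.inr)

/-- The number `α(p, q)` of connected components, in the stack of `p` on top of `q`, all of whose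
vertices lie in the middle row. -/
noncomputable def middleCount (p : Setoid (B ⊕ C)) (q : Setoid (A ⊕ B)) : ℕ :=
  {c ∈ (stack p q).classes | c ⊆ Set.range fun b : B => (Sum.inr (Sum.inl b) : A ⊕ B ⊕ C)}.ncard

/-- The identity partition: every bottom vertex is joined to the top vertex above it. -/
def idSetoid (A : Type) : Setoid (A ⊕ A) := Setoid.ker (Sum.elim id id)

theorem glue_le {f : X → V} {r : Setoid X} {g : Y → V} {s : Setoid Y} {T : Setoid V}
    (hf : ∀ a b, r a b → T (f a) (f b)) (hg : ∀ a b, s a b → T (g a) (g b)) :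
    ∀ x y, glue f r g s x y → T x y := by
  intro x y h
  induction h with
  | rel x y h =>
    rcases h with ⟨a, b, h, rfl, rfl⟩ | ⟨a, b, h, rfl, rfl⟩
    · exact hf a b h
    · exact hg a b h
  | refl x => exact T.refl x
  | symm x y _ ih => exact T.symm ih
  | trans x y z _ _ ih ih' => exact T.trans ih ih'

theorem glue_left (f : X → V) {r : Setoid X} (g : Y → V) (s : Setoid Y) {a b : X} (h : r a b) :
    glue f r g s (f a) (f b) :=
  Relation.EqvGen.rel _ _ (Or.inl ⟨a, b, h, rfl, rfl⟩)

theorem glue_right (f : X → V) (r : Setoid X) (g : Y → V) {s : Setoid Y} {a b : Y} (h : s a b) :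
    glue f r g s (g a) (g b) :=
  Relation.EqvGen.rel _ _ (Or.inr ⟨a, b, h, rfl, rfl⟩)

section Elim

variable {U W O R : Type} (u : U → V) (w : W → V) (eu : O → U) (ew : O → W) (r : R → W)
  (σ : Setoid U) (ρ : Setoid R)

theorem glue_elim (hu : Function.Injective u) (hw : Function.Injective w)
    (hsq : ∀ o, u (eu o) = w (ew o)) (hpb : ∀ x y, u x = w y → ∃ o, eu o = x ∧ ew o = y)
    (x y : W) :
    glue u σ (w ∘ r) ρ (w x) (w y) ↔ glue ew (σ.comap eu) r ρ x y := by
  constructor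
  · intro h
    set S' := glue ew (σ.comap eu) r ρ with hS'
    let N : V → V → Prop := fun v v' => v = v' ∨ ∃ a b, σ a b ∧ u a = v ∧ u b = v'
    have Nsymm : ∀ {a b}, N a b → N b a := by
      rintro a b (rfl | ⟨x, y, h, rfl, rfl⟩)
      · exact Or.inl rfl
      · exact Or.inr ⟨y, x, σ.symm h, rfl, rfl⟩
    have Ntrans : ∀ {a b c}, N a b → N b c → N a c := by
      rintro a b c (rfl | ⟨x, y, h, rfl, rfl⟩) h'
      · exact h'
      · rcases h' with rfl | ⟨x', y', h', e, rfl⟩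
        · exact Or.inr ⟨x, y, h, rfl, rfl⟩
        · obtain rfl := hu e
          exact Or.inr ⟨x, y', σ.trans h h', rfl, rfl⟩
    have NW : ∀ {x y}, N (w x) (w y) → S' x y := by
      rintro x y (h | ⟨a, b, h, h1, h2⟩)
      · rw [hw h]
      · obtain ⟨o, rfl, rfl⟩ := hpb _ _ h1
        obtain ⟨o', rfl, rfl⟩ := hpb _ _ h2
        exact glue_left _ _ _ h
    let P : V → Set W := fun v => {y | ∃ y', N v (w y') ∧ S' y' y}
    have hP : ∀ v v', N v v' → P v = P v' := by
      intro v v' h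
      ext y
      exact ⟨fun ⟨y', h1, h2⟩ => ⟨y', Ntrans (Nsymm h) h1, h2⟩,
        fun ⟨y', h1, h2⟩ => ⟨y', Ntrans h h1, h2⟩⟩
    have hPW : ∀ x, P (w x) = {y | S' x y} := by
      intro x
      ext y
      exact ⟨fun ⟨y', h1, h2⟩ => S'.trans (NW h1) h2, fun h => ⟨x, Or.inl rfl, h⟩⟩
    have key := glue_le (T := Setoid.ker P) (f := u) (r := σ) (g := w ∘ r) (s := ρ)
      (fun a b h => hP _ _ (Or.inr ⟨a, b, h, rfl, rfl⟩))
      (fun a b h => by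
        change P (w (r a)) = P (w (r b))
        rw [hPW, hPW]
        have h' : S' (r a) (r b) := glue_right _ _ _ h
        ext y
        exact ⟨fun h1 => S'.trans (S'.symm h') h1, fun h1 => S'.trans h' h1⟩) _ _ h
    change P (w x) = P (w y) at key
    rw [hPW, hPW] at key
    have : y ∈ {z | S' y z} := S'.refl y
    rw [← key] at this
    exact this
  · refine glue_le (T := (glue u σ (w ∘ r) ρ).comap w) ?_ ?_ x y
    · intro a b h
      change glue u σ (w ∘ r) ρ (w (ew a)) (w (ew b))
      rw [← hsq, ← hsq]
      exact glue_left _ _ _ h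
    · intro a b h
      exact glue_right u σ (w ∘ r) h

/-- The closed components of a glued diagram, split according to whether they meet `W`. -/
theorem count_elim [Finite V] {Z : Set V}
    (hu : Function.Injective u) (hw : Function.Injective w)
    (hsq : ∀ o, u (eu o) = w (ew o)) (hpb : ∀ x y, u x = w y → ∃ o, eu o = x ∧ ew o = y)
    (hcov : ∀ v, (∃ x, u x = v) ∨ ∃ y, w y = v)
    (hZ : ∀ v, v ∈ Z ∨ ∃ y, w y = v) :
    {c ∈ (glue u σ (w ∘ r) ρ).classes | c ⊆ Z}.ncard =
      {c ∈ σ.classes | ∀ x ∈ c, ∀ o, eu o ≠ x}.ncard +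
      {c ∈ (glue ew (σ.comap eu) r ρ).classes | c ⊆ w ⁻¹' Z}.ncard := by
  have hel := glue_elim u w eu ew r σ ρ hu hw hsq hpb
  set T := glue u σ (w ∘ r) ρ with hT
  set S' := glue ew (σ.comap eu) r ρ with hS'
  have hdisj : ∀ x, (∀ o, eu o ≠ x) ↔ ∀ y, w y ≠ u x := by
    intro x
    constructor
    · intro h y e
      obtain ⟨o, ho, _⟩ := hpb _ _ e.symm
      exact h o ho
    · rintro h o rfl
      exact h (ew o) (hsq o).symm
  -- closed classes of `σ` stay classes of `T`
  have hcl : ∀ x, (∀ x', σ x' x → ∀ o, eu o ≠ x') → ∀ v, T v (u x) ↔ ∃ x', σ x' x ∧ u x' = v := by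
    intro x hx v
    constructor
    · intro h
      have key := glue_le (T := Setoid.ker fun v => ∃ x', σ x' x ∧ u x' = v)
        (f := u) (r := σ) (g := w ∘ r) (s := ρ)
        (fun a b h => by
          apply propext
          constructor
          · rintro ⟨x', h1, h2⟩
            obtain rfl := hu h2
            exact ⟨b, σ.trans (σ.symm h) h1, rfl⟩
          · rintro ⟨x', h1, h2⟩
            obtain rfl := hu h2
            exact ⟨a, σ.trans h h1, rfl⟩)
        (fun a b h => by
          apply propext
          constructor
          · rintro ⟨x', h1, h2⟩
            exact absurd h2.symm ((hdisj x').1 (hx x' h1) _)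
          · rintro ⟨x', h1, h2⟩
            exact absurd h2.symm ((hdisj x').1 (hx x' h1) _)) _ _ h
      have key' : (∃ x', σ x' x ∧ u x' = v) = (∃ x', σ x' x ∧ u x' = u x) := key
      rw [key']
      exact ⟨x, σ.refl x, rfl⟩
    · rintro ⟨x', h, rfl⟩
      exact glue_left _ _ _ h
  have hsplit : {c ∈ T.classes | c ⊆ Z} =
      {c ∈ T.classes | ∀ y, w y ∉ c} ∪ {c ∈ T.classes | c ⊆ Z ∧ ∃ y, w y ∈ c} := by
    ext c
    simp only [Set.mem_ofPred_eq, Set.mem_union]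
    constructor
    · rintro ⟨h, h'⟩
      by_cases hc : ∃ y, w y ∈ c
      · exact Or.inr ⟨h, h', hc⟩
      · exact Or.inl ⟨h, fun y hy => hc ⟨y, hy⟩⟩
    · rintro (⟨h, h'⟩ | ⟨h, h', _⟩)
      · refine ⟨h, fun v hv => ?_⟩
        rcases hZ v with h1 | ⟨y, rfl⟩
        · exact h1
        · exact absurd hv (h' y)
      · exact ⟨h, h'⟩
  rw [hsplit, Set.ncard_union_eq ?_ (Set.toFinite _) (Set.toFinite _)]
  · congr 1
    · symm
      refine Set.ncard_congr (fun c _ => u '' c) ?_ ?_ ?_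
      · rintro _ ⟨⟨x, rfl⟩, hc⟩
        have hc' : ∀ x', σ x' x → ∀ o, eu o ≠ x' := fun x' h => hc x' h
        refine ⟨⟨u x, ?_⟩, ?_⟩
        · ext v
          simp only [Set.mem_image, Set.mem_ofPred_eq]
          rw [hcl x hc' v]
        · rintro y ⟨x', h, e⟩
          exact (hdisj x').1 (hc x' h) y e.symm
      · intro c c' _ _ h
        exact hu.image_injective h
      · rintro _ ⟨⟨v, rfl⟩, hc⟩
        obtain ⟨x, rfl⟩ : ∃ x, u x = v := by
          rcases hcov v with h | ⟨y, rfl⟩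
          · exact h
          · exact absurd (T.refl _) (hc y)
        have hc' : ∀ x', σ x' x → ∀ o, eu o ≠ x' := by
          intro x' h
          rw [hdisj]
          intro y e
          refine hc y ?_
          change T (w y) (u x)
          rw [e]
          exact glue_left _ _ _ h
        refine ⟨{x' | σ x' x}, ⟨⟨x, rfl⟩, fun x' h => hc' x' h⟩, ?_⟩
        ext v
        simp only [Set.mem_image, Set.mem_ofPred_eq]
        rw [hcl x hc' v]
    · refine Set.ncard_congr (fun c _ => w ⁻¹' c) ?_ ?_ ?_
      · rintro _ ⟨⟨v, rfl⟩, hc, y, hy⟩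
        refine ⟨⟨y, ?_⟩, Set.preimage_mono hc⟩
        ext y'
        simp only [Set.mem_preimage, Set.mem_ofPred_eq]
        rw [← hel]
        exact ⟨fun h => T.trans h (T.symm hy), fun h => T.trans h hy⟩
      · rintro _ _ ⟨⟨v, rfl⟩, hc, y, hy⟩ ⟨⟨v', rfl⟩, hc', y', hy'⟩ h
        have : y ∈ w ⁻¹' {x | T x v'} := by
          rw [← h]
          exact hy
        have hy2 : T (w y) v' := this
        have hy1 : T (w y) v := hy
        have hvv : T v v' := T.trans (T.symm hy1) hy2
        ext z
        exact ⟨fun h => T.trans h hvv, fun h => T.trans h (T.symm hvv)⟩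
      · rintro _ ⟨⟨y, rfl⟩, hc⟩
        refine ⟨{v | T v (w y)}, ⟨⟨w y, rfl⟩, ?_, y, T.refl _⟩, ?_⟩
        · intro v hv
          rcases hZ v with h | ⟨y', rfl⟩
          · exact h
          · exact hc ((hel _ _).1 hv)
        · ext y'
          exact hel y' y
  · rw [Set.disjoint_left]
    rintro c ⟨_, h⟩ ⟨_, _, y, hy⟩
    exact h y hy

end Elim

variable {D : Type}

/-- Connectivity of a stack of three partitions. -/
def stack3 (p : Setoid (C ⊕ D)) (q : Setoid (B ⊕ C)) (r : Setoid (A ⊕ B)) :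
    Setoid (A ⊕ B ⊕ C ⊕ D) :=
  glue (Sum.map id (Sum.map id Sum.inl)) (stack q r) (Sum.inr ∘ Sum.inr) p

theorem stack3_eq (p : Setoid (C ⊕ D)) (q : Setoid (B ⊕ C)) (r : Setoid (A ⊕ B)) :
    glue Sum.inr (stack p q) (Sum.map id Sum.inl) r = stack3 p q r := by
  apply le_antisymm
  · intro x y
    refine glue_le (T := stack3 p q r) ?_ ?_ x y
    · refine glue_le (T := (stack3 p q r).comap Sum.inr) ?_ ?_
      · intro a b h
        have := glue_left (Sum.map id (Sum.map id Sum.inl)) (Sum.inr ∘ Sum.inr) p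
          (glue_right (V := A ⊕ B ⊕ C) (Sum.map id Sum.inl) r Sum.inr h)
        rcases a with a | a <;> rcases b with b | b <;> exact this
      · intro a b h
        exact glue_right (V := A ⊕ B ⊕ C ⊕ D) (Sum.map id (Sum.map id Sum.inl)) (stack q r)
          (Sum.inr ∘ Sum.inr) h
    · intro a b h
      have := glue_left (Sum.map id (Sum.map id Sum.inl)) (Sum.inr ∘ Sum.inr) p
        (glue_left (V := A ⊕ B ⊕ C) (Sum.map id Sum.inl) Sum.inr q h)
      rcases a with a | a <;> rcases b with b | b <;> exact this
  · intro x y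
    refine glue_le (T := glue Sum.inr (stack p q) (Sum.map id Sum.inl) r) ?_ ?_ x y
    · refine glue_le (T := (glue Sum.inr (stack p q) (Sum.map id Sum.inl) r).comap
        (Sum.map id (Sum.map id Sum.inl))) ?_ ?_
      · intro a b h
        have := glue_right (V := A ⊕ B ⊕ C ⊕ D) Sum.inr (stack p q) (Sum.map id Sum.inl) h
        rcases a with a | a <;> rcases b with b | b <;> exact this
      · intro a b h
        have := glue_left (V := A ⊕ B ⊕ C ⊕ D) Sum.inr (Sum.map id Sum.inl) r
          (glue_left (V := B ⊕ C ⊕ D) (Sum.map id Sum.inl) Sum.inr p h)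
        rcases a with a | a <;> rcases b with b | b <;> exact this
    · intro a b h
      exact glue_left (V := A ⊕ B ⊕ C ⊕ D) Sum.inr (Sum.map id Sum.inl) r
        (glue_right (V := B ⊕ C ⊕ D) (Sum.map id Sum.inl) q Sum.inr h)

theorem glue_comm {V X Y : Type} (f : X → V) (r : Setoid X) (g : Y → V) (s : Setoid Y) :
    glue f r g s = glue g s f r := by
  apply le_antisymm
  · intro x y
    exact glue_le (fun a b h => glue_right _ _ _ h) (fun a b h => glue_left _ _ _ h) x y
  · intro x y
    exact glue_le (fun a b h => glue_right _ _ _ h) (fun a b h => glue_left _ _ _ h) x y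

theorem stack3_eq' (p : Setoid (C ⊕ D)) (q : Setoid (B ⊕ C)) (r : Setoid (A ⊕ B)) :
    stack3 p q r = glue Sum.inr (stack p q)
      (Sum.map id (Sum.map id Sum.inr) ∘ Sum.map id Sum.inl) r := by
  rw [← stack3_eq]
  congr 1
  funext x
  rcases x with x | x <;> rfl

theorem star_assoc (p : Setoid (C ⊕ D)) (q : Setoid (B ⊕ C)) (r : Setoid (A ⊕ B)) :
    star (star p q) r = star p (star q r) := by
  ext x y
  have h1 := glue_elim (Sum.map id (Sum.map id Sum.inl) : A ⊕ B ⊕ C → A ⊕ B ⊕ C ⊕ D)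
    (Sum.map id Sum.inr : A ⊕ C ⊕ D → A ⊕ B ⊕ C ⊕ D) (Sum.map id Sum.inr : A ⊕ C → A ⊕ B ⊕ C)
    (Sum.map id Sum.inl) Sum.inr (stack q r) p
    (Function.Injective.sumMap Function.injective_id (Function.Injective.sumMap Function.injective_id Sum.inl_injective))
    (Function.Injective.sumMap Function.injective_id Sum.inr_injective)
    (by rintro (a | a) <;> rfl)
    (by rintro (a | a | a) (b | b | b) h <;> simp at h ⊢ <;> simp [h])
    (Sum.map id Sum.inr x) (Sum.map id Sum.inr y)
  have h2 := glue_elim (Sum.inr : B ⊕ C ⊕ D → A ⊕ B ⊕ C ⊕ D)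
    (Sum.map id (Sum.map id Sum.inr) : A ⊕ B ⊕ D → A ⊕ B ⊕ C ⊕ D)
    (Sum.map id Sum.inr : B ⊕ D → B ⊕ C ⊕ D)
    Sum.inr (Sum.map id Sum.inl) (stack p q) r
    Sum.inr_injective
    (Function.Injective.sumMap Function.injective_id (Function.Injective.sumMap Function.injective_id Sum.inr_injective))
    (by rintro (a | a) <;> rfl)
    (by rintro (a | a | a) (b | b | b) h <;> simp at h ⊢ <;> simp [h])
    (Sum.map id Sum.inr x) (Sum.map id Sum.inr y)
  rw [← stack3_eq', glue_comm] at h2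
  have h1' : stack3 p q r _ _ ↔ star p (star q r) x y := h1
  have h2' : stack3 p q r _ _ ↔ star (star p q) r x y := h2
  rw [← h1', ← h2']
  rcases x with x | x <;> rcases y with y | y <;> rfl

theorem middleCount_assoc [Finite A] [Finite B] [Finite C] [Finite D]
    (p : Setoid (C ⊕ D)) (q : Setoid (B ⊕ C)) (r : Setoid (A ⊕ B)) :
    middleCount p q + middleCount (star p q) r = middleCount q r + middleCount p (star q r) := by
  let Z : Set (A ⊕ B ⊕ C ⊕ D) := {v | (∃ b, Sum.inr (Sum.inl b) = v) ∨
    ∃ c, Sum.inr (Sum.inr (Sum.inl c)) = v}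
  have h1 := count_elim (Sum.map id (Sum.map id Sum.inl) : A ⊕ B ⊕ C → A ⊕ B ⊕ C ⊕ D)
    (Sum.map id Sum.inr : A ⊕ C ⊕ D → A ⊕ B ⊕ C ⊕ D) (Sum.map id Sum.inr : A ⊕ C → A ⊕ B ⊕ C)
    (Sum.map id Sum.inl) Sum.inr (stack q r) p (Z := Z)
    (Function.Injective.sumMap Function.injective_id (Function.Injective.sumMap Function.injective_id Sum.inl_injective))
    (Function.Injective.sumMap Function.injective_id Sum.inr_injective)
    (by rintro (a | a) <;> rfl)
    (by rintro (a | a | a) (b | b | b) h <;> simp at h ⊢ <;> simp [h])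
    (by rintro (a | a | a | a) <;> simp)
    (by rintro (a | a | a | a) <;> simp [Z])
  have h2 := count_elim (Sum.inr : B ⊕ C ⊕ D → A ⊕ B ⊕ C ⊕ D)
    (Sum.map id (Sum.map id Sum.inr) : A ⊕ B ⊕ D → A ⊕ B ⊕ C ⊕ D)
    (Sum.map id Sum.inr : B ⊕ D → B ⊕ C ⊕ D)
    Sum.inr (Sum.map id Sum.inl) (stack p q) r (Z := Z)
    Sum.inr_injective
    (Function.Injective.sumMap Function.injective_id (Function.Injective.sumMap Function.injective_id Sum.inr_injective))
    (by rintro (a | a) <;> rfl)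
    (by rintro (a | a | a) (b | b | b) h <;> simp at h ⊢ <;> simp [h])
    (by rintro (a | a | a | a) <;> simp)
    (by rintro (a | a | a | a) <;> simp [Z])
  rw [← stack3_eq', glue_comm Sum.inr] at h2
  have e : ∀ {A B C : Type} (c : Set (A ⊕ B ⊕ C)), (∀ x ∈ c, ∀ o : A ⊕ C, Sum.map id Sum.inr o ≠ x) ↔
      c ⊆ Set.range fun b : B => (Sum.inr (Sum.inl b) : A ⊕ B ⊕ C) := by
    intro A B C c
    refine forall_congr' fun x => forall_congr' fun _ => ?_
    rcases x with x | x | x <;> simp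
  have z1 : (Sum.map id Sum.inr : A ⊕ C ⊕ D → A ⊕ B ⊕ C ⊕ D) ⁻¹' Z =
      Set.range fun b : C => (Sum.inr (Sum.inl b) : A ⊕ C ⊕ D) := by
    ext x
    rcases x with x | x | x <;> simp [Z]
  have z2 : (Sum.map id (Sum.map id Sum.inr) : A ⊕ B ⊕ D → A ⊕ B ⊕ C ⊕ D) ⁻¹' Z =
      Set.range fun b : B => (Sum.inr (Sum.inl b) : A ⊕ B ⊕ D) := by
    ext x
    rcases x with x | x | x <;> simp [Z]
  rw [z1] at h1
  rw [z2] at h2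
  simp only [e] at h1 h2
  exact h2.symm.trans h1

theorem star_id (p : Setoid (A ⊕ B)) : star p (idSetoid A) = p := by
  ext x y
  constructor
  · intro h
    have := glue_le (T := p.comap (Sum.elim Sum.inl id)) (f := Sum.map id Sum.inl)
      (r := idSetoid A) (g := Sum.inr) (s := p)
      (by
        intro a b h
        have h' : Sum.elim id id a = Sum.elim id id b := h
        rcases a with a | a <;> rcases b with b | b <;> obtain rfl : a = b := h' <;>
          exact p.refl _)
      (fun a b h => h) _ _ h
    rcases x with x | x <;> rcases y with y | y <;> exact this
  · intro h
    have h1 : ∀ x : A ⊕ B, stack p (idSetoid A) (Sum.map id Sum.inr x) (Sum.inr x) := by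
      rintro (x | x)
      · exact glue_left (V := A ⊕ A ⊕ B) (r := idSetoid A) (a := Sum.inl x) (b := Sum.inr x)
          (Sum.map id Sum.inl) Sum.inr p rfl
      · exact (stack p (idSetoid A)).refl _
    exact (stack p (idSetoid A)).trans (h1 x) ((stack p (idSetoid A)).trans (glue_right _ _ _ h)
      ((stack p (idSetoid A)).symm (h1 y)))

theorem id_star (p : Setoid (A ⊕ B)) : star (idSetoid B) p = p := by
  ext x y
  constructor
  · intro h
    have := glue_le (T := p.comap (Sum.elim Sum.inl (Sum.elim Sum.inr Sum.inr)))
      (f := Sum.map id Sum.inl) (r := p) (g := Sum.inr) (s := idSetoid B)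
      (by
        intro a b h
        rcases a with a | a <;> rcases b with b | b <;> exact h)
      (by
        intro a b h
        have h' : Sum.elim id id a = Sum.elim id id b := h
        rcases a with a | a <;> rcases b with b | b <;> obtain rfl : a = b := h' <;>
          exact p.refl _)
      _ _ h
    rcases x with x | x <;> rcases y with y | y <;> exact this
  · intro h
    have h1 : ∀ x : A ⊕ B, stack (idSetoid B) p (Sum.map id Sum.inr x) (Sum.map id Sum.inl x) := by
      rintro (x | x)
      · exact (stack (idSetoid B) p).refl _
      · exact glue_right (V := A ⊕ B ⊕ B) (s := idSetoid B) (a := Sum.inr x) (b := Sum.inl x)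
          (Sum.map id Sum.inl) p Sum.inr rfl
    exact (stack (idSetoid B) p).trans (h1 x) ((stack (idSetoid B) p).trans (glue_left _ _ _ h)
      ((stack (idSetoid B) p).symm (h1 y)))

theorem middleCount_id [Finite A] [Finite B] (p : Setoid (A ⊕ B)) : middleCount p (idSetoid A) = 0 := by
  rw [middleCount, Set.ncard_eq_zero (Set.toFinite _), Set.eq_empty_iff_forall_notMem]
  intro c
  simp only [Set.mem_ofPred_eq, not_and]
  rintro ⟨v, rfl⟩ h
  obtain ⟨b, rfl⟩ := h ((stack p (idSetoid A)).refl v)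
  have h1 : (Sum.inl b : A ⊕ A ⊕ B) ∈ {x | stack p (idSetoid A) x (Sum.inr (Sum.inl b))} :=
    glue_left (V := A ⊕ A ⊕ B) (r := idSetoid A) (a := Sum.inl b) (b := Sum.inr b)
      (Sum.map id Sum.inl) Sum.inr p rfl
  obtain ⟨_, h2⟩ := h h1
  simp at h2

theorem id_middleCount [Finite A] [Finite B] (p : Setoid (A ⊕ B)) : middleCount (idSetoid B) p = 0 := by
  rw [middleCount, Set.ncard_eq_zero (Set.toFinite _), Set.eq_empty_iff_forall_notMem]
  intro c
  simp only [Set.mem_ofPred_eq, not_and]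
  rintro ⟨v, rfl⟩ h
  obtain ⟨b, rfl⟩ := h ((stack (idSetoid B) p).refl v)
  have h1 : (Sum.inr (Sum.inr b) : A ⊕ B ⊕ B) ∈
      {x | stack (idSetoid B) p x (Sum.inr (Sum.inl b))} :=
    glue_right (V := A ⊕ B ⊕ B) (s := idSetoid B) (a := Sum.inr b) (b := Sum.inl b)
      (Sum.map id Sum.inl) p Sum.inr rfl
  obtain ⟨_, h2⟩ := h h1
  simp at h2

end Stack

/-! ### The partition category -/

section Par

variable {𝕜 : Type u} [CommRing 𝕜]

/-- Horizontal juxtaposition of partitions, `p` on the left and `q` on the right. -/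
@[reducible]
def Partition.tensor {k l k' l' : ℕ} (p : Partition k l) (q : Partition k' l') :
    Partition (k + k') (l + l') :=
  (show Setoid ((Fin k ⊕ Fin l) ⊕ (Fin k' ⊕ Fin l')) from
    { r := Sum.LiftRel p q
      iseqv :=
        { refl := by
            rintro (x | x)
            · exact Sum.LiftRel.inl (p.refl x)
            · exact Sum.LiftRel.inr (q.refl x)
          symm := by
            rintro _ _ (h | h)
            · exact Sum.LiftRel.inl (p.symm h)
            · exact Sum.LiftRel.inr (q.symm h)
          trans := by
            rintro _ _ _ (h | h) (h' | h')
            · exact Sum.LiftRel.inl (p.trans h h')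
            · exact Sum.LiftRel.inr (q.trans h h') } }).comap
    (Equiv.sumSumSumComm (Fin k) (Fin k') (Fin l) (Fin l') ∘
      Sum.map finSumFinEquiv.symm finSumFinEquiv.symm)

/-- The objects of the partition category `Par(t)` are the natural numbers. -/
structure Par (t : 𝕜) : Type where
  num : ℕ

namespace Par

variable {t : 𝕜}

/-- Morphisms of `Par(t)`: formal linear combinations of partitions. -/
abbrev Hom (X Y : Par t) : Type u := Partition X.num Y.num →₀ 𝕜

/-- Vertical composition `f ∘ g`: the bilinear map with `p ∘ q = t ^ α(p, q) • (p ⋆ q)`. -/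
noncomputable def compBilin (X Y Z : Par t) : Hom Y Z →ₗ[𝕜] Hom X Y →ₗ[𝕜] Hom X Z :=
  Finsupp.lift _ 𝕜 _ fun p => Finsupp.lift _ 𝕜 _ fun q =>
    Finsupp.single (star p q) (t ^ middleCount p q)

/-- Horizontal composition `f ⊗ g`: the bilinear extension of juxtaposition. -/
noncomputable def tensor {k l k' l' : ℕ} :
    Hom (⟨k⟩ : Par t) ⟨l⟩ →ₗ[𝕜] Hom (⟨k'⟩ : Par t) ⟨l'⟩ →ₗ[𝕜]
      Hom (⟨k + k'⟩ : Par t) ⟨l + l'⟩ :=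
  Finsupp.lift _ 𝕜 _ fun p => Finsupp.lift _ 𝕜 _ fun q => Finsupp.single (p.tensor q) 1

theorem compBilin_single {X Y Z : Par t} (p : Partition Y.num Z.num) (q : Partition X.num Y.num)
    (a b : 𝕜) : compBilin X Y Z (Finsupp.single p a) (Finsupp.single q b) =
      Finsupp.single (star p q) (a * b * t ^ middleCount p q) := by
  have h : ∀ c d : 𝕜, c • d • (Finsupp.single (star p q) (t ^ middleCount p q) : Hom X Z) =
      Finsupp.single (star p q) (c * d * t ^ middleCount p q) := by
    intro c d
    rw [Finsupp.smul_single, Finsupp.smul_single, smul_eq_mul, smul_eq_mul, mul_assoc]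
  rw [← h]
  have h1 : compBilin X Y Z (Finsupp.single p a) = a • Finsupp.lift _ 𝕜 _ fun q =>
      (Finsupp.single (star p q) (t ^ middleCount p q) : Hom X Z) :=
    Finsupp.sum_single_index (zero_smul _ _)
  rw [h1, LinearMap.smul_apply]
  congr 1
  exact Finsupp.sum_single_index (zero_smul _ _)

noncomputable instance : Category.{u} (Par t) where
  Hom X Y := Hom X Y
  id X := Finsupp.single (idSetoid (Fin X.num)) 1
  comp {X Y Z} f g := compBilin X Y Z g f
  id_comp {X Y} f := by
    induction f using Finsupp.induction_linear with
    | zero => simp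
    | add f g hf hg => rw [map_add, LinearMap.add_apply, hf, hg]
    | single p a => simp [compBilin_single, star_id, middleCount_id]
  comp_id {X Y} f := by
    induction f using Finsupp.induction_linear with
    | zero => simp
    | add f g hf hg => rw [map_add, hf, hg]
    | single p a => simp [compBilin_single, id_star, id_middleCount]
  assoc {W X Y Z} f g h := by
    induction f using Finsupp.induction_linear with
    | zero => simp
    | add f f' hf hf' => simp only [map_add, hf, hf']
    | single r c =>
    induction g using Finsupp.induction_linear with
    | zero => simp
    | add f f' hf hf' => simp only [map_add, LinearMap.add_apply, hf, hf']
    | single q b =>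
    induction h using Finsupp.induction_linear with
    | zero => simp
    | add f f' hf hf' => simp only [map_add, LinearMap.add_apply, hf, hf']
    | single p a =>
    simp only [compBilin_single, star_assoc]
    congr 1
    have h := middleCount_assoc p q r
    calc a * (b * c * t ^ middleCount q r) * t ^ middleCount p (star q r)
        = a * b * c * t ^ (middleCount q r + middleCount p (star q r)) := by
          rw [pow_add]; ring
      _ = a * b * t ^ middleCount p q * c * t ^ middleCount (star p q) r := by
          rw [← h, pow_add]; ring

noncomputable instance : Preadditive (Par t) where
  homGroup X Y := inferInstanceAs (AddCommGroup (Hom X Y))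
  add_comp _ _ _ f f' g := (compBilin _ _ _ g).map_add f f'
  comp_add _ _ _ f g g' := by
    exact LinearMap.congr_fun ((compBilin _ _ _).map_add g g') f

noncomputable instance : Linear 𝕜 (Par t) where
  homModule X Y := inferInstanceAs (Module 𝕜 (Hom X Y))
  smul_comp _ _ _ a f g := (compBilin _ _ _ g).map_smul a f
  comp_smul _ _ _ f a g := by
    exact LinearMap.congr_fun ((compBilin _ _ _).map_smul a g) f

/-- A partition, as a morphism of `Par(t)`. -/
noncomputable def ofPartition (t : 𝕜) {k l : ℕ} (p : Partition k l) : (⟨k⟩ : Par t) ⟶ ⟨l⟩ :=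
  (Finsupp.single p 1 : Hom (⟨k⟩ : Par t) ⟨l⟩)

end Par

/-- The partition algebra `P_k(t)`. -/
abbrev PartitionAlgebra (t : 𝕜) (k : ℕ) : Type u := End (⟨k⟩ : Par t)

/-- The span of the Motzkin diagrams in `P_k(t)`. -/
noncomputable def motzkinSpan (t : 𝕜) (k : ℕ) : Submodule 𝕜 (PartitionAlgebra t k) :=
  Submodule.span 𝕜 (Set.range fun D : MotzkinDiagram k k => Par.ofPartition t D.1)

end Par

/-! ### Strict linear monoidal categories by generators and relations

We present strict `𝕜`-linear monoidal categories with one generating object; its tensor powers,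
that is, the objects, are identified with the natural numbers. -/

section Presentation

/-- Formal `𝕜`-linear expressions in the generating morphisms `G k l`, built with identities,
vertical composition `comp f g` (`f ∘ g`, first `g`, then `f`) and tensor product. -/
inductive FreeMor (𝕜 : Type u) (G : ℕ → ℕ → Type) : ℕ → ℕ → Type u
  | of {k l : ℕ} (g : G k l) : FreeMor 𝕜 G k l
  | id (k : ℕ) : FreeMor 𝕜 G k k
  | comp {k l m : ℕ} (f : FreeMor 𝕜 G l m) (g : FreeMor 𝕜 G k l) : FreeMor 𝕜 G k m
  | tensor {k l k' l' : ℕ} (f : FreeMor 𝕜 G k l) (g : FreeMor 𝕜 G k' l') :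
      FreeMor 𝕜 G (k + k') (l + l')
  | zero {k l : ℕ} : FreeMor 𝕜 G k l
  | add {k l : ℕ} (f g : FreeMor 𝕜 G k l) : FreeMor 𝕜 G k l
  | smul {k l : ℕ} (a : 𝕜) (f : FreeMor 𝕜 G k l) : FreeMor 𝕜 G k l

/-- Transport of an expression along equalities of its source and target. -/
def FreeMor.cast {𝕜 : Type u} {G : ℕ → ℕ → Type} {k l k' l' : ℕ} (hk : k = k') (hl : l = l')
    (f : FreeMor 𝕜 G k l) : FreeMor 𝕜 G k' l' :=
  hk ▸ hl ▸ f

/-- A family of relations between parallel expressions. -/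
abbrev Relations (𝕜 : Type u) (G : ℕ → ℕ → Type) : Type u :=
  ∀ k l : ℕ, FreeMor 𝕜 G k l → FreeMor 𝕜 G k l → Prop

open FreeMor in
/-- The smallest congruence that contains the relations `R` and the axioms of a strict
`𝕜`-linear monoidal category. -/
inductive MorEq {𝕜 : Type u} [CommRing 𝕜] {G : ℕ → ℕ → Type} (R : Relations 𝕜 G) :
    ∀ {k l : ℕ}, FreeMor 𝕜 G k l → FreeMor 𝕜 G k l → Prop
  -- the defining relations
  | of_rel {k l : ℕ} {f g : FreeMor 𝕜 G k l} : R k l f g → MorEq R f g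
  -- equivalence relation
  | refl {k l : ℕ} (f : FreeMor 𝕜 G k l) : MorEq R f f
  | symm {k l : ℕ} {f g : FreeMor 𝕜 G k l} : MorEq R f g → MorEq R g f
  | trans {k l : ℕ} {f g h : FreeMor 𝕜 G k l} : MorEq R f g → MorEq R g h → MorEq R f h
  -- congruence
  | comp_congr {k l m : ℕ} {f f' : FreeMor 𝕜 G l m} {g g' : FreeMor 𝕜 G k l} :
      MorEq R f f' → MorEq R g g' → MorEq R (comp f g) (comp f' g')
  | tensor_congr {k l k' l' : ℕ} {f f' : FreeMor 𝕜 G k l} {g g' : FreeMor 𝕜 G k' l'} :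
      MorEq R f f' → MorEq R g g' → MorEq R (tensor f g) (tensor f' g')
  | add_congr {k l : ℕ} {f f' g g' : FreeMor 𝕜 G k l} :
      MorEq R f f' → MorEq R g g' → MorEq R (add f g) (add f' g')
  | smul_congr {k l : ℕ} (a : 𝕜) {f f' : FreeMor 𝕜 G k l} :
      MorEq R f f' → MorEq R (smul a f) (smul a f')
  -- morphism spaces are `𝕜`-modules
  | add_assoc {k l : ℕ} (f g h : FreeMor 𝕜 G k l) :
      MorEq R (add (add f g) h) (add f (add g h))
  | add_comm {k l : ℕ} (f g : FreeMor 𝕜 G k l) : MorEq R (add f g) (add g f)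
  | zero_add {k l : ℕ} (f : FreeMor 𝕜 G k l) : MorEq R (add zero f) f
  | smul_add {k l : ℕ} (a : 𝕜) (f g : FreeMor 𝕜 G k l) :
      MorEq R (smul a (add f g)) (add (smul a f) (smul a g))
  | add_smul {k l : ℕ} (a b : 𝕜) (f : FreeMor 𝕜 G k l) :
      MorEq R (smul (a + b) f) (add (smul a f) (smul b f))
  | mul_smul {k l : ℕ} (a b : 𝕜) (f : FreeMor 𝕜 G k l) :
      MorEq R (smul (a * b) f) (smul a (smul b f))
  | one_smul {k l : ℕ} (f : FreeMor 𝕜 G k l) : MorEq R (smul 1 f) f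
  | zero_smul {k l : ℕ} (f : FreeMor 𝕜 G k l) : MorEq R (smul 0 f) zero
  | smul_zero {k l : ℕ} (a : 𝕜) : MorEq R (smul a (zero : FreeMor 𝕜 G k l)) zero
  -- category with bilinear composition
  | id_comp {k l : ℕ} (f : FreeMor 𝕜 G k l) : MorEq R (comp (id l) f) f
  | comp_id {k l : ℕ} (f : FreeMor 𝕜 G k l) : MorEq R (comp f (id k)) f
  | comp_assoc {k l m n : ℕ} (f : FreeMor 𝕜 G m n) (g : FreeMor 𝕜 G l m) (h : FreeMor 𝕜 G k l) :
      MorEq R (comp (comp f g) h) (comp f (comp g h))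
  | add_comp {k l m : ℕ} (f f' : FreeMor 𝕜 G l m) (g : FreeMor 𝕜 G k l) :
      MorEq R (comp (add f f') g) (add (comp f g) (comp f' g))
  | comp_add {k l m : ℕ} (f : FreeMor 𝕜 G l m) (g g' : FreeMor 𝕜 G k l) :
      MorEq R (comp f (add g g')) (add (comp f g) (comp f g'))
  | smul_comp {k l m : ℕ} (a : 𝕜) (f : FreeMor 𝕜 G l m) (g : FreeMor 𝕜 G k l) :
      MorEq R (comp (smul a f) g) (smul a (comp f g))
  | comp_smul {k l m : ℕ} (a : 𝕜) (f : FreeMor 𝕜 G l m) (g : FreeMor 𝕜 G k l) :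
      MorEq R (comp f (smul a g)) (smul a (comp f g))
  -- the tensor product is a bilinear bifunctor
  | tensor_id (k l : ℕ) : MorEq R (tensor (id k) (id l)) (id (k + l))
  | tensor_comp {k l m k' l' m' : ℕ} (f : FreeMor 𝕜 G l m) (g : FreeMor 𝕜 G k l)
      (f' : FreeMor 𝕜 G l' m') (g' : FreeMor 𝕜 G k' l') :
      MorEq R (tensor (comp f g) (comp f' g')) (comp (tensor f f') (tensor g g'))
  | add_tensor {k l k' l' : ℕ} (f f' : FreeMor 𝕜 G k l) (g : FreeMor 𝕜 G k' l') :
      MorEq R (tensor (add f f') g) (add (tensor f g) (tensor f' g))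
  | tensor_add {k l k' l' : ℕ} (f : FreeMor 𝕜 G k l) (g g' : FreeMor 𝕜 G k' l') :
      MorEq R (tensor f (add g g')) (add (tensor f g) (tensor f g'))
  | smul_tensor {k l k' l' : ℕ} (a : 𝕜) (f : FreeMor 𝕜 G k l) (g : FreeMor 𝕜 G k' l') :
      MorEq R (tensor (smul a f) g) (smul a (tensor f g))
  | tensor_smul {k l k' l' : ℕ} (a : 𝕜) (f : FreeMor 𝕜 G k l) (g : FreeMor 𝕜 G k' l') :
      MorEq R (tensor f (smul a g)) (smul a (tensor f g))
  -- the tensor product is strictly associative and unital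
  | tensor_assoc {k l k' l' k'' l'' : ℕ} (f : FreeMor 𝕜 G k l) (g : FreeMor 𝕜 G k' l')
      (h : FreeMor 𝕜 G k'' l'') :
      MorEq R (FreeMor.cast (Nat.add_assoc k k' k'') (Nat.add_assoc l l' l'')
        (tensor (tensor f g) h)) (tensor f (tensor g h))
  | id_tensor {k l : ℕ} (f : FreeMor 𝕜 G k l) :
      MorEq R (FreeMor.cast (Nat.zero_add k) (Nat.zero_add l) (tensor (id 0) f)) f
  | tensor_id_zero {k l : ℕ} (f : FreeMor 𝕜 G k l) :
      MorEq R (FreeMor.cast (Nat.add_zero k) (Nat.add_zero l) (tensor f (id 0))) f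

variable {𝕜 : Type u} [CommRing 𝕜] {G : ℕ → ℕ → Type}

/-- The strict `𝕜`-linear monoidal category with one generating object, generating morphisms `G`
and relations `R`. Its objects are the natural numbers. -/
structure Presented (R : Relations 𝕜 G) : Type where
  num : ℕ

namespace Presented

variable {R : Relations 𝕜 G}

/-- Equality of expressions in the presented category. -/
@[reducible]
def setoid (R : Relations 𝕜 G) (k l : ℕ) : Setoid (FreeMor 𝕜 G k l) :=
  ⟨MorEq R, MorEq.refl, MorEq.symm, MorEq.trans⟩

/-- Morphisms of the presented category: classes of expressions. -/
def Hom (X Y : Presented R) : Type u := Quotient (setoid R X.num Y.num)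

instance : Category.{u} (Presented R) where
  Hom X Y := Hom X Y
  id X := Quotient.mk _ (FreeMor.id X.num)
  comp {_ _ _} f g :=
    Quotient.map₂ (fun g f => FreeMor.comp g f) (fun _ _ h _ _ h' => MorEq.comp_congr h h') g f
  id_comp := by
    rintro _ _ ⟨f⟩
    exact Quotient.sound (MorEq.comp_id f)
  comp_id := by
    rintro _ _ ⟨f⟩
    exact Quotient.sound (MorEq.id_comp f)
  assoc := by
    rintro _ _ _ _ ⟨f⟩ ⟨g⟩ ⟨h⟩
    exact Quotient.sound (MorEq.symm (MorEq.comp_assoc h g f))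

/-- The morphism represented by an expression. -/
def ofMor (R : Relations 𝕜 G) {k l : ℕ} (f : FreeMor 𝕜 G k l) : (⟨k⟩ : Presented R) ⟶ ⟨l⟩ :=
  Quotient.mk (setoid R k l) f

/-- The tensor product of morphisms. -/
def tensor {k l k' l' : ℕ} (f : (⟨k⟩ : Presented R) ⟶ ⟨l⟩) (g : (⟨k'⟩ : Presented R) ⟶ ⟨l'⟩) :
    (⟨k + k'⟩ : Presented R) ⟶ ⟨l + l'⟩ :=
  Quotient.map₂ (sa := setoid R k l) (sb := setoid R k' l') (sc := setoid R (k + k') (l + l'))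
    FreeMor.tensor (fun _ _ h _ _ h' => MorEq.tensor_congr h h') f g

instance (X Y : Presented R) : Add (X ⟶ Y) where
  add f g := Quotient.map₂ (sa := setoid R X.num Y.num) (sb := setoid R X.num Y.num)
    (sc := setoid R X.num Y.num) FreeMor.add (fun _ _ h _ _ h' => MorEq.add_congr h h') f g

instance (X Y : Presented R) : Zero (X ⟶ Y) where
  zero := Quotient.mk (setoid R X.num Y.num) FreeMor.zero

instance (X Y : Presented R) : Neg (X ⟶ Y) where
  neg f := Quotient.map (sa := setoid R X.num Y.num) (sb := setoid R X.num Y.num)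
    (FreeMor.smul (-1)) (fun _ _ h => MorEq.smul_congr (-1) h) f

instance (X Y : Presented R) : AddCommGroup (X ⟶ Y) where
  nsmul := nsmulRec
  zsmul := zsmulRec
  add_assoc := by
    rintro ⟨f⟩ ⟨g⟩ ⟨h⟩
    exact Quotient.sound (MorEq.add_assoc f g h)
  zero_add := by
    rintro ⟨f⟩
    exact Quotient.sound (MorEq.zero_add f)
  add_zero := by
    rintro ⟨f⟩
    exact Quotient.sound (MorEq.trans (MorEq.add_comm _ _) (MorEq.zero_add f))
  add_comm := by
    rintro ⟨f⟩ ⟨g⟩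
    exact Quotient.sound (MorEq.add_comm f g)
  neg_add_cancel := by
    rintro ⟨f⟩
    refine Quotient.sound (MorEq.trans
      (MorEq.add_congr (MorEq.refl _) (MorEq.symm (MorEq.one_smul f))) ?_)
    refine MorEq.trans (MorEq.symm (MorEq.add_smul _ _ f)) ?_
    rw [neg_add_cancel]
    exact MorEq.zero_smul f

instance (X Y : Presented R) : Module 𝕜 (X ⟶ Y) where
  smul a f := Quotient.map (sa := setoid R X.num Y.num) (sb := setoid R X.num Y.num)
    (FreeMor.smul a) (fun _ _ h => MorEq.smul_congr a h) f
  one_smul := by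
    rintro ⟨f⟩
    exact Quotient.sound (MorEq.one_smul f)
  mul_smul := by
    rintro a b ⟨f⟩
    exact Quotient.sound (MorEq.mul_smul a b f)
  smul_zero a := Quotient.sound (MorEq.smul_zero a)
  smul_add := by
    rintro a ⟨f⟩ ⟨g⟩
    exact Quotient.sound (MorEq.smul_add a f g)
  add_smul := by
    rintro a b ⟨f⟩
    exact Quotient.sound (MorEq.add_smul a b f)
  zero_smul := by
    rintro ⟨f⟩
    exact Quotient.sound (MorEq.zero_smul f)

instance : Preadditive (Presented R) where
  add_comp := by
    rintro _ _ _ ⟨f⟩ ⟨f'⟩ ⟨g⟩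
    exact Quotient.sound (MorEq.comp_add g f f')
  comp_add := by
    rintro _ _ _ ⟨f⟩ ⟨g⟩ ⟨g'⟩
    exact Quotient.sound (MorEq.add_comp g g' f)

instance : Linear 𝕜 (Presented R) where
  smul_comp := by
    rintro _ _ _ a ⟨f⟩ ⟨g⟩
    exact Quotient.sound (MorEq.comp_smul a g f)
  comp_smul := by
    rintro _ _ _ ⟨f⟩ a ⟨g⟩
    exact Quotient.sound (MorEq.smul_comp a g f)

/-- The morphisms that can be built from generators and identities by compositions and tensor
products alone (no linear combinations). -/
inductive IsMonomial : ∀ {k l : ℕ}, ((⟨k⟩ : Presented R) ⟶ ⟨l⟩) → Prop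
  | of {k l : ℕ} (g : G k l) : IsMonomial (ofMor R (FreeMor.of g))
  | id (k : ℕ) : IsMonomial (𝟙 (⟨k⟩ : Presented R))
  | comp {k l m : ℕ} {f : (⟨l⟩ : Presented R) ⟶ ⟨m⟩} {g : (⟨k⟩ : Presented R) ⟶ ⟨l⟩} :
      IsMonomial f → IsMonomial g → IsMonomial (g ≫ f)
  | tensor {k l k' l' : ℕ} {f : (⟨k⟩ : Presented R) ⟶ ⟨l⟩} {g : (⟨k'⟩ : Presented R) ⟶ ⟨l'⟩} :
      IsMonomial f → IsMonomial g → IsMonomial (tensor f g)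

end Presented

end Presentation

/-! ### The Motzkin category -/

section Motzkin

variable {𝕜 : Type u} [CommRing 𝕜]

/-- The generating morphisms of the Motzkin category: cap `d`, cup `c`, unit dot `η` and counit
dot `ε`. -/
inductive MotzkinGen : ℕ → ℕ → Type
  | d : MotzkinGen 2 0
  | c : MotzkinGen 0 2
  | η : MotzkinGen 0 1
  | ε : MotzkinGen 1 0

open FreeMor MotzkinGen in
/-- The defining relations of the Motzkin category, with their transforms under the reflections
`*` (in a horizontal line: exchanges `d, c` and `η, ε` and reverses compositions) and `♯` (in a
vertical line: fixes the generators and reverses tensor products). -/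
inductive MotzkinRel (t : 𝕜) : Relations 𝕜 MotzkinGen
  /-- `d ∘ (1 ⊗ η) = ε` -/
  | cap_dot : MotzkinRel t 1 0 (comp (of d) (tensor (id 1) (of η))) (of ε)
  /-- `♯` of `cap_dot` -/
  | cap_dot_sharp : MotzkinRel t 1 0 (comp (of d) (tensor (of η) (id 1))) (of ε)
  /-- `*` of `cap_dot` -/
  | cup_dot : MotzkinRel t 0 1 (comp (tensor (id 1) (of ε)) (of c)) (of η)
  /-- `♯` of `cup_dot` -/
  | cup_dot_sharp : MotzkinRel t 0 1 (comp (tensor (of ε) (id 1)) (of c)) (of η)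
  /-- `(d ⊗ 1) ∘ (1 ⊗ c) = 1` -/
  | zigzag : MotzkinRel t 1 1
      (comp (tensor (of d) (id 1)) (tensor (id 1) (of c))) (id 1)
  /-- both `*` and `♯` of `zigzag` -/
  | zigzag_sharp : MotzkinRel t 1 1
      (comp (tensor (id 1) (of d)) (tensor (of c) (id 1))) (id 1)
  /-- `d ∘ c = t • 1`, invariant under both reflections -/
  | bubble : MotzkinRel t 0 0 (comp (of d) (of c)) (smul t (id 0))
  /-- `ε ∘ η = t • 1`, invariant under both reflections -/
  | dots : MotzkinRel t 0 0 (comp (of ε) (of η)) (smul t (id 0))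

/-- The Motzkin category `M(t)`. -/
abbrev Motzkin (t : 𝕜) : Type := Presented (MotzkinRel t)

/-- A generator, as a morphism of `M(t)`. -/
def Motzkin.gen (t : 𝕜) {k l : ℕ} (g : MotzkinGen k l) : (⟨k⟩ : Motzkin t) ⟶ ⟨l⟩ :=
  Presented.ofMor (MotzkinRel t) (FreeMor.of g)

/-- `J` is the strict `𝕜`-linear monoidal functor `M(t) → Par(t)` that is the identity on objects
and sends `d, c, η, ε` to the partitions they depict, each of which has exactly one block. -/
structure IsDiagramFunctor (t : 𝕜)
    (J : ∀ k l : ℕ, ((⟨k⟩ : Motzkin t) ⟶ ⟨l⟩) →ₗ[𝕜] ((⟨k⟩ : Par t) ⟶ ⟨l⟩)) : Prop where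
  map_id (k : ℕ) : J k k (𝟙 _) = 𝟙 _
  map_comp {k l m : ℕ} (f : (⟨k⟩ : Motzkin t) ⟶ ⟨l⟩) (g : (⟨l⟩ : Motzkin t) ⟶ ⟨m⟩) :
    J k m (f ≫ g) = J k l f ≫ J l m g
  map_tensor {k l k' l' : ℕ} (f : (⟨k⟩ : Motzkin t) ⟶ ⟨l⟩) (g : (⟨k'⟩ : Motzkin t) ⟶ ⟨l'⟩) :
    J (k + k') (l + l') (Presented.tensor f g) = Par.tensor (J k l f) (J k' l' g)
  map_gen {k l : ℕ} (g : MotzkinGen k l) :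
    J k l (Motzkin.gen t g) = Par.ofPartition t (⊤ : Partition k l)

end Motzkin

end MotzkinCat

/-! The functor `J` exists because the partition category satisfies the axioms of a strict linear
monoidal category and the eight defining relations. `J` interprets expressions, and
`FreeMor.toPar_eq` passes to classes. Distinct partitions are linearly independent, so any family of
morphisms mapped by `J` to distinct Motzkin diagrams is linearly independent. It remains to produce
monomials over all Motzkin diagrams and to show that they span.

Bending the last strand with a cup or a cap is a bijection between the morphisms `k + 1 → l` and `k
→ l + 1`, by the zigzag relations. Under `J` it becomes a relabelling of vertices that preserves
their boundary positions, hence Motzkin diagrams (`toPar_unbend`, `boundaryPos_bendEquiv`). This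
reduces everything to `l = 0`.

Motzkin diagrams without top vertices are Motzkin paths from height `0` to height `0`: a singleton
is a level step, and a pair is an up step with a matching down step. More generally, paths ending at
height `j` are the Motzkin diagrams in which all `j` top vertices are joined to bottom ones
(`exists_diagram_eq`, `diagram_injective`). Each path has a monomial `epi` with this diagram.

For spanning, consider the composites of an `epi` with a `mono`. The morphisms that preserve their
span under precomposition form a linear subcategory. It is stable under adding a strand on the
right, because bending preserves these spans. By `mem_of_closed` only the generators to the right of
identity strands remain, and these follow from the last steps of a path. Applied to the identity of
`0`, this gives `epiSpan_zero`. Finally `J` is injective, and its image on endomorphisms is the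
Motzkin span. -/

namespace MotzkinCat

/-! ### Tensor calculus in a presented category -/

namespace Presented

variable {𝕜 : Type u} [CommRing 𝕜] {G : ℕ → ℕ → Type} {R : Relations 𝕜 G}

theorem ofMor_surjective {k l : ℕ} (f : (⟨k⟩ : Presented R) ⟶ ⟨l⟩) :
    ∃ x : FreeMor 𝕜 G k l, ofMor R x = f :=
  Quotient.exists_rep f

theorem ofMor_eq {k l : ℕ} {x y : FreeMor 𝕜 G k l} (h : MorEq R x y) : ofMor R x = ofMor R y :=
  Quotient.sound h

theorem tensor_id (k l : ℕ) :
    tensor (𝟙 (⟨k⟩ : Presented R)) (𝟙 (⟨l⟩ : Presented R)) = 𝟙 (⟨k + l⟩ : Presented R) :=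
  Quotient.sound (MorEq.tensor_id k l)

theorem tensor_comp {k l m k' l' m' : ℕ} (f : (⟨k⟩ : Presented R) ⟶ ⟨l⟩)
    (g : (⟨l⟩ : Presented R) ⟶ ⟨m⟩) (f' : (⟨k'⟩ : Presented R) ⟶ ⟨l'⟩)
    (g' : (⟨l'⟩ : Presented R) ⟶ ⟨m'⟩) :
    tensor (f ≫ g) (f' ≫ g') = tensor f f' ≫ tensor g g' := by
  obtain ⟨f, rfl⟩ := ofMor_surjective f
  obtain ⟨g, rfl⟩ := ofMor_surjective g
  obtain ⟨f', rfl⟩ := ofMor_surjective f'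
  obtain ⟨g', rfl⟩ := ofMor_surjective g'
  exact Quotient.sound (MorEq.tensor_comp g f g' f')

/-- The tensor product of morphisms as a bilinear map. -/
def tensorₗ (k l k' l' : ℕ) : ((⟨k⟩ : Presented R) ⟶ ⟨l⟩) →ₗ[𝕜] ((⟨k'⟩ : Presented R) ⟶ ⟨l'⟩) →ₗ[𝕜]
    ((⟨k + k'⟩ : Presented R) ⟶ ⟨l + l'⟩) :=
  LinearMap.mk₂ 𝕜 tensor
    (by rintro ⟨f⟩ ⟨f'⟩ ⟨g⟩; exact Quotient.sound (MorEq.add_tensor f f' g))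
    (by rintro a ⟨f⟩ ⟨g⟩; exact Quotient.sound (MorEq.smul_tensor a f g))
    (by rintro ⟨f⟩ ⟨g⟩ ⟨g'⟩; exact Quotient.sound (MorEq.tensor_add f g g'))
    (by rintro a ⟨f⟩ ⟨g⟩; exact Quotient.sound (MorEq.tensor_smul a f g))

/-- Tensor product with the identity of the generating object on the right. -/
def whisker {k l : ℕ} : ((⟨k⟩ : Presented R) ⟶ ⟨l⟩) →ₗ[𝕜] ((⟨k + 1⟩ : Presented R) ⟶ ⟨l + 1⟩) :=
  (tensorₗ k l 1 1).flip (𝟙 (⟨1⟩ : Presented R))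

theorem whisker_apply {k l : ℕ} (f : (⟨k⟩ : Presented R) ⟶ ⟨l⟩) :
    whisker f = tensor f (𝟙 (⟨1⟩ : Presented R)) := rfl

/-- A morphism placed to the right of the identity of `a`. -/
def shift (a : ℕ) {k l : ℕ} :
    ((⟨k⟩ : Presented R) ⟶ ⟨l⟩) →ₗ[𝕜] ((⟨a + k⟩ : Presented R) ⟶ ⟨a + l⟩) :=
  tensorₗ a a k l (𝟙 (⟨a⟩ : Presented R))

theorem shift_apply (a : ℕ) {k l : ℕ} (f : (⟨k⟩ : Presented R) ⟶ ⟨l⟩) :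
    shift a f = tensor (𝟙 (⟨a⟩ : Presented R)) f := rfl

theorem whisker_id (k : ℕ) : whisker (𝟙 (⟨k⟩ : Presented R)) = 𝟙 (⟨k + 1⟩ : Presented R) :=
  tensor_id k 1

theorem whisker_comp {k l m : ℕ} (f : (⟨k⟩ : Presented R) ⟶ ⟨l⟩) (g : (⟨l⟩ : Presented R) ⟶ ⟨m⟩) :
    whisker (f ≫ g) = whisker f ≫ whisker g := by
  simp only [whisker_apply, ← tensor_comp, Category.comp_id]

theorem shift_id (a k : ℕ) : shift a (𝟙 (⟨k⟩ : Presented R)) = 𝟙 (⟨a + k⟩ : Presented R) :=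
  tensor_id a k

theorem shift_comp (a : ℕ) {k l m : ℕ} (f : (⟨k⟩ : Presented R) ⟶ ⟨l⟩)
    (g : (⟨l⟩ : Presented R) ⟶ ⟨m⟩) : shift a (f ≫ g) = shift a f ≫ shift a g := by
  simp only [shift_apply, ← tensor_comp, Category.comp_id]

/-- Together with `tensor_eq_shift_comp` this is the interchange law. Comparing the two for a
generator `g` lets `f` slide past it. -/
theorem tensor_eq_comp_shift {k l k' l' : ℕ} (f : (⟨k⟩ : Presented R) ⟶ ⟨l⟩)
    (g : (⟨k'⟩ : Presented R) ⟶ ⟨l'⟩) :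
    tensor f g = tensor f (𝟙 (⟨k'⟩ : Presented R)) ≫ shift l g := by
  rw [shift_apply, ← tensor_comp, Category.comp_id, Category.id_comp]

theorem tensor_eq_shift_comp {k l k' l' : ℕ} (f : (⟨k⟩ : Presented R) ⟶ ⟨l⟩)
    (g : (⟨k'⟩ : Presented R) ⟶ ⟨l'⟩) :
    tensor f g = shift k g ≫ tensor f (𝟙 (⟨l'⟩ : Presented R)) := by
  rw [shift_apply, ← tensor_comp, Category.comp_id, Category.id_comp]

/-- No transport is needed, since `k + 0` is definitionally `k`. For the same reason associativity
needs none when the last factor is the identity of `1`, as in `whisker_tensor`. -/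
theorem tensor_id_zero {k l : ℕ} (f : (⟨k⟩ : Presented R) ⟶ ⟨l⟩) :
    tensor f (𝟙 (⟨0⟩ : Presented R)) = f := by
  obtain ⟨f, rfl⟩ := ofMor_surjective f
  exact Quotient.sound (MorEq.tensor_id_zero f)

theorem whisker_tensor {k l k' l' : ℕ} (f : (⟨k⟩ : Presented R) ⟶ ⟨l⟩)
    (g : (⟨k'⟩ : Presented R) ⟶ ⟨l'⟩) : whisker (tensor f g) = tensor f (whisker g) := by
  obtain ⟨f, rfl⟩ := ofMor_surjective f
  obtain ⟨g, rfl⟩ := ofMor_surjective g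
  exact Quotient.sound (MorEq.tensor_assoc f g (FreeMor.id 1))

theorem tensor_id_succ {k l : ℕ} (f : (⟨k⟩ : Presented R) ⟶ ⟨l⟩) (b : ℕ) :
    tensor f (𝟙 (⟨b + 1⟩ : Presented R)) = whisker (tensor f (𝟙 (⟨b⟩ : Presented R))) := by
  rw [whisker_tensor, whisker_id]

theorem tensor_id_two {k l : ℕ} (f : (⟨k⟩ : Presented R) ⟶ ⟨l⟩) :
    tensor f (𝟙 (⟨2⟩ : Presented R)) = whisker (whisker f) := by
  rw [whisker_apply f, whisker_tensor, whisker_id]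

theorem shift_whisker (a : ℕ) {k l : ℕ} (f : (⟨k⟩ : Presented R) ⟶ ⟨l⟩) :
    shift a (whisker f) = whisker (shift a f) :=
  (whisker_tensor (𝟙 (⟨a⟩ : Presented R)) f).symm

/-- Shifting by `1` and then by `a` is shifting by `a + 1`; stated for the sources and targets for
which the associativity of addition is definitional. -/
theorem shift_shift_one_zero_one (a : ℕ) (f : (⟨0⟩ : Presented R) ⟶ ⟨1⟩) :
    shift a (shift 1 f) = shift (a + 1) f := by
  obtain ⟨f, rfl⟩ := ofMor_surjective f
  have h := ofMor_eq (R := R)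
    (MorEq.symm (MorEq.tensor_assoc (FreeMor.id a) (FreeMor.id 1) f))
  refine Eq.trans h ?_
  exact Quotient.sound (MorEq.tensor_congr (MorEq.tensor_id a 1) (MorEq.refl f))

theorem shift_shift_one_one_zero (a : ℕ) (f : (⟨1⟩ : Presented R) ⟶ ⟨0⟩) :
    shift a (shift 1 f) = shift (a + 1) f := by
  obtain ⟨f, rfl⟩ := ofMor_surjective f
  have h := ofMor_eq (R := R)
    (MorEq.symm (MorEq.tensor_assoc (FreeMor.id a) (FreeMor.id 1) f))
  refine Eq.trans h ?_
  exact Quotient.sound (MorEq.tensor_congr (MorEq.tensor_id a 1) (MorEq.refl f))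

theorem shift_shift_one_zero_two (a : ℕ) (f : (⟨0⟩ : Presented R) ⟶ ⟨2⟩) :
    shift a (shift 1 f) = shift (a + 1) f := by
  obtain ⟨f, rfl⟩ := ofMor_surjective f
  have h := ofMor_eq (R := R)
    (MorEq.symm (MorEq.tensor_assoc (FreeMor.id a) (FreeMor.id 1) f))
  refine Eq.trans h ?_
  exact Quotient.sound (MorEq.tensor_congr (MorEq.tensor_id a 1) (MorEq.refl f))

theorem shift_shift_one_two_zero (a : ℕ) (f : (⟨2⟩ : Presented R) ⟶ ⟨0⟩) :
    shift a (shift 1 f) = shift (a + 1) f := by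
  obtain ⟨f, rfl⟩ := ofMor_surjective f
  have h := ofMor_eq (R := R)
    (MorEq.symm (MorEq.tensor_assoc (FreeMor.id a) (FreeMor.id 1) f))
  refine Eq.trans h ?_
  exact Quotient.sound (MorEq.tensor_congr (MorEq.tensor_id a 1) (MorEq.refl f))

/-! ### An induction principle for morphisms -/

section Closure

variable (P : ∀ m n : ℕ, Submodule 𝕜 ((⟨m⟩ : Presented R) ⟶ ⟨n⟩))
  (id_mem : ∀ n, 𝟙 (⟨n⟩ : Presented R) ∈ P n n)
  (comp_mem : ∀ {k l m : ℕ} {f : (⟨k⟩ : Presented R) ⟶ ⟨l⟩} {g : (⟨l⟩ : Presented R) ⟶ ⟨m⟩},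
    f ∈ P k l → g ∈ P l m → f ≫ g ∈ P k m)
  (whisker_mem : ∀ {k l : ℕ} {f : (⟨k⟩ : Presented R) ⟶ ⟨l⟩}, f ∈ P k l → whisker f ∈ P _ _)

theorem ofMor_cast_mem {k l k' l' : ℕ} (hk : k = k') (hl : l = l') {f : FreeMor 𝕜 G k l}
    (hf : ofMor R f ∈ P k l) : ofMor R (FreeMor.cast hk hl f) ∈ P k' l' := by
  subst hk hl
  exact hf

include id_mem comp_mem whisker_mem in
-- Only whiskering on the right is assumed, so identities on the left are carried along by
-- quantifying over `a`. For a tensor product, associativity and interchange write `1_a ⊗ (f ⊗ g)`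
-- as `(1_a ⊗ f) ⊗ 1` followed by `g` to the right of an identity.
theorem shift_ofMor_mem
    (gen_mem : ∀ (a : ℕ) {k l : ℕ} (g : G k l), shift a (ofMor R (FreeMor.of g)) ∈ P _ _)
    {k l : ℕ} (f : FreeMor 𝕜 G k l) : ∀ a, shift a (ofMor R f) ∈ P _ _ := by
  induction f with
  | of g => exact fun a => gen_mem a g
  | id k =>
    intro a
    have := id_mem (a + k)
    rwa [← shift_id] at this
  | comp f g hf hg =>
    intro a
    have := comp_mem (hg a) (hf a)
    rwa [← shift_comp] at this
  | @tensor k l k' l' f g hf hg =>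
    intro a
    have h1 : ∀ b, tensor (shift a (ofMor R f)) (𝟙 (⟨b⟩ : Presented R)) ∈ P _ _ := by
      intro b
      induction b with
      | zero =>
        rw [tensor_id_zero]
        exact hf a
      | succ b ih =>
        rw [tensor_id_succ]
        exact whisker_mem ih
    have h2 : tensor (shift a (ofMor R f)) (ofMor R g) ∈ P _ _ := by
      rw [tensor_eq_comp_shift]
      exact comp_mem (h1 k') (hg _)
    -- Strict associativity holds only up to transport along `a + k + k' = a + (k + k')`, which is
    -- harmless for membership in `P`.
    have h3 := ofMor_cast_mem P (Nat.add_assoc a k k') (Nat.add_assoc a l l')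
      (f := ((FreeMor.id a).tensor f).tensor g) h2
    rwa [ofMor_eq (MorEq.tensor_assoc _ _ _)] at h3
  | @zero k l =>
    intro a
    have : shift a (ofMor R (FreeMor.zero : FreeMor 𝕜 G k l)) = 0 :=
      map_zero (shift (R := R) (k := k) (l := l) a)
    rw [this]
    exact zero_mem _
  | add f g hf hg =>
    intro a
    have : shift a (ofMor R (f.add g)) = shift a (ofMor R f) + shift a (ofMor R g) :=
      map_add (shift a) (ofMor R f) (ofMor R g)
    rw [this]
    exact add_mem (hf a) (hg a)
  | smul c f hf =>
    intro a
    have : shift a (ofMor R (f.smul c)) = c • shift a (ofMor R f) :=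
      map_smul (shift a) c (ofMor R f)
    rw [this]
    exact Submodule.smul_mem _ c (hf a)

include id_mem comp_mem whisker_mem in
/-- A linear subcategory that is stable under right whiskering and contains all right-aligned
generators is everything. -/
theorem mem_of_closed
    (gen_mem : ∀ (a : ℕ) {k l : ℕ} (g : G k l), shift a (ofMor R (FreeMor.of g)) ∈ P _ _)
    {k l : ℕ} (f : (⟨k⟩ : Presented R) ⟶ ⟨l⟩) : f ∈ P k l := by
  obtain ⟨f, rfl⟩ := ofMor_surjective f
  have := ofMor_cast_mem P (Nat.zero_add k) (Nat.zero_add l)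
    (shift_ofMor_mem P id_mem comp_mem whisker_mem gen_mem f 0)
  rwa [ofMor_eq (MorEq.id_tensor f)] at this

end Closure

end Presented

open Presented

/-! ### Generators to the right of identity strands -/

namespace Motzkin

variable {𝕜 : Type u} [CommRing 𝕜] {t : 𝕜}

/-- The cap `1_a ⊗ d`. -/
def cap (t : 𝕜) (a : ℕ) : (⟨a + 1 + 1⟩ : Motzkin t) ⟶ ⟨a⟩ := shift a (gen t MotzkinGen.d)

/-- The cup `1_a ⊗ c`. -/
def cup (t : 𝕜) (a : ℕ) : (⟨a⟩ : Motzkin t) ⟶ ⟨a + 1 + 1⟩ := shift a (gen t MotzkinGen.c)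

/-- The unit dot `1_a ⊗ η`. -/
def unitDot (t : 𝕜) (a : ℕ) : (⟨a⟩ : Motzkin t) ⟶ ⟨a + 1⟩ := shift a (gen t MotzkinGen.η)

/-- The counit dot `1_a ⊗ ε`. -/
def counitDot (t : 𝕜) (a : ℕ) : (⟨a + 1⟩ : Motzkin t) ⟶ ⟨a⟩ := shift a (gen t MotzkinGen.ε)

/-! ### Sliding a morphism past a generator on its right -/

section Naturality

variable {k l : ℕ} (f : (⟨k⟩ : Motzkin t) ⟶ ⟨l⟩)

theorem tensor_counit : tensor f (gen t MotzkinGen.ε) = counitDot t k ≫ f := by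
  rw [tensor_eq_shift_comp, tensor_id_zero]
  rfl

theorem whisker_counitDot : whisker f ≫ counitDot t l = counitDot t k ≫ f := by
  rw [← tensor_counit, tensor_eq_comp_shift]
  rfl

theorem unitDot_whisker : unitDot t k ≫ whisker f = f ≫ unitDot t l := by
  have h1 := tensor_eq_comp_shift f (gen t MotzkinGen.η)
  have h2 := tensor_eq_shift_comp f (gen t MotzkinGen.η)
  rw [tensor_id_zero] at h1
  exact h2.symm.trans h1

theorem whisker_cap : whisker (whisker f) ≫ cap t l = cap t k ≫ f := by
  have h1 := tensor_eq_comp_shift f (gen t MotzkinGen.d)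
  have h2 := tensor_eq_shift_comp f (gen t MotzkinGen.d)
  rw [tensor_id_two] at h1
  rw [tensor_id_zero] at h2
  exact h1.symm.trans h2

theorem cup_whisker : cup t k ≫ whisker (whisker f) = f ≫ cup t l := by
  have h1 := tensor_eq_comp_shift f (gen t MotzkinGen.c)
  have h2 := tensor_eq_shift_comp f (gen t MotzkinGen.c)
  rw [tensor_id_zero] at h1
  rw [tensor_id_two] at h2
  exact h2.symm.trans h1

end Naturality

/-! ### The defining relations to the right of `a` strands -/

section LocalRelations

theorem rel {k l : ℕ} {x y : FreeMor 𝕜 MotzkinGen k l} (h : MotzkinRel t k l x y) :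
    ofMor (MotzkinRel t) x = ofMor (MotzkinRel t) y :=
  ofMor_eq (MorEq.of_rel h)

variable (t) (a : ℕ)

theorem unitDot_cap : unitDot t (a + 1) ≫ cap t a = counitDot t a := by
  have h : shift 1 (gen t MotzkinGen.η) ≫ gen t MotzkinGen.d = gen t MotzkinGen.ε :=
    rel MotzkinRel.cap_dot
  have h' := congrArg (shift a) h
  rw [shift_comp, shift_shift_one_zero_one] at h'
  exact h'

theorem whisker_unitDot_cap : whisker (unitDot t a) ≫ cap t a = counitDot t a := by
  have h : whisker (gen t MotzkinGen.η) ≫ gen t MotzkinGen.d = gen t MotzkinGen.ε :=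
    rel MotzkinRel.cap_dot_sharp
  have h' := congrArg (shift a) h
  rw [shift_comp, shift_whisker] at h'
  exact h'

theorem cup_counitDot : cup t a ≫ counitDot t (a + 1) = unitDot t a := by
  have h : gen t MotzkinGen.c ≫ shift 1 (gen t MotzkinGen.ε) = gen t MotzkinGen.η :=
    rel MotzkinRel.cup_dot
  have h' := congrArg (shift a) h
  rw [shift_comp, shift_shift_one_one_zero] at h'
  exact h'

theorem cup_whisker_counitDot : cup t a ≫ whisker (counitDot t a) = unitDot t a := by
  have h : gen t MotzkinGen.c ≫ whisker (gen t MotzkinGen.ε) = gen t MotzkinGen.η :=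
    rel MotzkinRel.cup_dot_sharp
  have h' := congrArg (shift a) h
  rw [shift_comp, shift_whisker] at h'
  exact h'

theorem cup_whisker_cap : cup t (a + 1) ≫ whisker (cap t a) = 𝟙 _ := by
  have h : shift 1 (gen t MotzkinGen.c) ≫ whisker (gen t MotzkinGen.d) = 𝟙 (⟨1⟩ : Motzkin t) :=
    rel MotzkinRel.zigzag
  have h' := congrArg (shift a) h
  rw [shift_comp, shift_whisker, shift_shift_one_zero_two, shift_id] at h'
  exact h'

theorem whisker_cup_cap : whisker (cup t a) ≫ cap t (a + 1) = 𝟙 _ := by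
  have h : whisker (gen t MotzkinGen.c) ≫ shift 1 (gen t MotzkinGen.d) = 𝟙 (⟨1⟩ : Motzkin t) :=
    rel MotzkinRel.zigzag_sharp
  have h' := congrArg (shift a) h
  rw [shift_comp, shift_whisker, shift_shift_one_two_zero, shift_id] at h'
  exact h'

theorem cup_cap : cup t a ≫ cap t a = t • 𝟙 _ := by
  have h : gen t MotzkinGen.c ≫ gen t MotzkinGen.d = t • 𝟙 (⟨0⟩ : Motzkin t) :=
    rel MotzkinRel.bubble
  have h' := congrArg (shift a) h
  rw [shift_comp, map_smul, shift_id] at h'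
  exact h'

theorem unitDot_counitDot : unitDot t a ≫ counitDot t a = t • 𝟙 _ := by
  have h : gen t MotzkinGen.η ≫ gen t MotzkinGen.ε = t • 𝟙 (⟨0⟩ : Motzkin t) :=
    rel MotzkinRel.dots
  have h' := congrArg (shift a) h
  rw [shift_comp, map_smul, shift_id] at h'
  exact h'

end LocalRelations

/-! ### Bending the last strand -/

/-- Bend the last top strand down. -/
def bend {k l : ℕ} (f : (⟨k⟩ : Motzkin t) ⟶ ⟨l + 1⟩) : (⟨k + 1⟩ : Motzkin t) ⟶ ⟨l⟩ :=
  whisker f ≫ cap t l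

/-- Bend the last bottom strand up. -/
def unbend {k l : ℕ} : ((⟨k + 1⟩ : Motzkin t) ⟶ ⟨l⟩) →ₗ[𝕜] ((⟨k⟩ : Motzkin t) ⟶ ⟨l + 1⟩) :=
  Linear.leftComp 𝕜 _ (cup t k) ∘ₗ whisker

theorem unbend_apply {k l : ℕ} (f : (⟨k + 1⟩ : Motzkin t) ⟶ ⟨l⟩) :
    unbend f = cup t k ≫ whisker f := rfl

/-- Sliding `f` past the cup brings the cup and the cap together into a zigzag. In `bend_unbend` it
slides past the cap instead, and the other zigzag appears. -/
theorem unbend_bend {k l : ℕ} (f : (⟨k⟩ : Motzkin t) ⟶ ⟨l + 1⟩) : unbend (bend f) = f := by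
  rw [unbend_apply, bend, whisker_comp, ← Category.assoc, cup_whisker, Category.assoc,
    cup_whisker_cap, Category.comp_id]

theorem bend_unbend {k l : ℕ} (f : (⟨k + 1⟩ : Motzkin t) ⟶ ⟨l⟩) : bend (unbend f) = f := by
  rw [unbend_apply, bend, whisker_comp, Category.assoc, whisker_cap, ← Category.assoc,
    whisker_cup_cap, Category.id_comp]

end Motzkin

/-! ### Motzkin paths -/

/-- Motzkin paths of length `k` from height `0` to height `j`. -/
inductive MotzkinPath : ℕ → ℕ → Type
  | nil : MotzkinPath 0 0
  | level {k j : ℕ} (w : MotzkinPath k j) : MotzkinPath (k + 1) j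
  | up {k j : ℕ} (w : MotzkinPath k j) : MotzkinPath (k + 1) (j + 1)
  | down {k j : ℕ} (w : MotzkinPath k (j + 1)) : MotzkinPath (k + 1) j

namespace MotzkinPath

open Motzkin

variable {𝕜 : Type u} [CommRing 𝕜] (t : 𝕜)

/-- The morphism of a Motzkin path: its up steps start strands, which the down steps close. -/
def epi : ∀ {k j : ℕ}, MotzkinPath k j → ((⟨k⟩ : Motzkin t) ⟶ ⟨j⟩)
  | _, _, nil => 𝟙 _
  | _, _, level w => counitDot t _ ≫ epi w
  | _, _, up w => whisker (epi w)
  | _, _, down w => whisker (epi w) ≫ cap t _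

/-- The mirror image, in a horizontal line, of the morphism of a Motzkin path. -/
def mono : ∀ {k j : ℕ}, MotzkinPath k j → ((⟨j⟩ : Motzkin t) ⟶ ⟨k⟩)
  | _, _, nil => 𝟙 _
  | _, _, level w => mono w ≫ unitDot t _
  | _, _, up w => whisker (mono w)
  | _, _, down w => cup t _ ≫ whisker (mono w)

/-- The span of the morphisms of Motzkin paths. -/
def epiSpan (k j : ℕ) : Submodule 𝕜 ((⟨k⟩ : Motzkin t) ⟶ ⟨j⟩) :=
  Submodule.span 𝕜 (Set.range fun w : MotzkinPath k j => w.epi t)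

/-- The span of the mirror images of the morphisms of Motzkin paths. -/
def monoSpan (k j : ℕ) : Submodule 𝕜 ((⟨j⟩ : Motzkin t) ⟶ ⟨k⟩) :=
  Submodule.span 𝕜 (Set.range fun w : MotzkinPath k j => w.mono t)

/-- The span of the morphisms with an epi-mono factorization along Motzkin paths. -/
def factorSpan (n h : ℕ) : Submodule 𝕜 ((⟨n⟩ : Motzkin t) ⟶ ⟨h⟩) :=
  Submodule.span 𝕜 {f | ∃ (j : ℕ) (w : MotzkinPath n j) (v : MotzkinPath h j),
    w.epi t ≫ v.mono t = f}

variable {t}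

theorem epi_mem {k j : ℕ} (w : MotzkinPath k j) : w.epi t ∈ epiSpan t k j :=
  Submodule.subset_span ⟨w, rfl⟩

theorem mono_mem {k j : ℕ} (w : MotzkinPath k j) : w.mono t ∈ monoSpan t k j :=
  Submodule.subset_span ⟨w, rfl⟩

theorem map_mem_of_epi {k j k' j' : ℕ}
    (F : ((⟨k⟩ : Motzkin t) ⟶ ⟨j⟩) →ₗ[𝕜] ((⟨k'⟩ : Motzkin t) ⟶ ⟨j'⟩))
    {S : Submodule 𝕜 ((⟨k'⟩ : Motzkin t) ⟶ ⟨j'⟩)}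
    (h : ∀ w : MotzkinPath k j, F (w.epi t) ∈ S) {x : (⟨k⟩ : Motzkin t) ⟶ ⟨j⟩}
    (hx : x ∈ epiSpan t k j) : F x ∈ S := by
  refine (Submodule.span_le (p := S.comap F)).2 ?_ hx
  rintro _ ⟨w, rfl⟩
  exact h w

theorem map_mem_of_mono {k j k' j' : ℕ}
    (F : ((⟨j⟩ : Motzkin t) ⟶ ⟨k⟩) →ₗ[𝕜] ((⟨k'⟩ : Motzkin t) ⟶ ⟨j'⟩))
    {S : Submodule 𝕜 ((⟨k'⟩ : Motzkin t) ⟶ ⟨j'⟩)}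
    (h : ∀ w : MotzkinPath k j, F (w.mono t) ∈ S) {x : (⟨j⟩ : Motzkin t) ⟶ ⟨k⟩}
    (hx : x ∈ monoSpan t k j) : F x ∈ S := by
  refine (Submodule.span_le (p := S.comap F)).2 ?_ hx
  rintro _ ⟨w, rfl⟩
  exact h w

theorem counitDot_comp_mem {k j : ℕ} {x : (⟨k⟩ : Motzkin t) ⟶ ⟨j⟩} (hx : x ∈ epiSpan t k j) :
    counitDot t k ≫ x ∈ epiSpan t (k + 1) j :=
  map_mem_of_epi (Linear.leftComp 𝕜 _ (counitDot t k)) (fun w => epi_mem w.level) hx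

theorem whisker_mem_epiSpan {k j : ℕ} {x : (⟨k⟩ : Motzkin t) ⟶ ⟨j⟩} (hx : x ∈ epiSpan t k j) :
    whisker x ∈ epiSpan t (k + 1) (j + 1) :=
  map_mem_of_epi whisker (fun w => epi_mem w.up) hx

theorem bend_mem_epiSpan {k j : ℕ} {x : (⟨k⟩ : Motzkin t) ⟶ ⟨j + 1⟩}
    (hx : x ∈ epiSpan t k (j + 1)) : whisker x ≫ cap t j ∈ epiSpan t (k + 1) j :=
  map_mem_of_epi (Linear.rightComp 𝕜 _ (cap t j) ∘ₗ whisker) (fun w => epi_mem w.down) hx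

theorem comp_unitDot_mem {k j : ℕ} {x : (⟨j⟩ : Motzkin t) ⟶ ⟨k⟩} (hx : x ∈ monoSpan t k j) :
    x ≫ unitDot t k ∈ monoSpan t (k + 1) j :=
  map_mem_of_mono (Linear.rightComp 𝕜 _ (unitDot t k)) (fun w => mono_mem w.level) hx

theorem whisker_mem_monoSpan {k j : ℕ} {x : (⟨j⟩ : Motzkin t) ⟶ ⟨k⟩} (hx : x ∈ monoSpan t k j) :
    whisker x ∈ monoSpan t (k + 1) (j + 1) :=
  map_mem_of_mono whisker (fun w => mono_mem w.up) hx

theorem unbend_mem_monoSpan {k j : ℕ} {x : (⟨j + 1⟩ : Motzkin t) ⟶ ⟨k⟩}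
    (hx : x ∈ monoSpan t k (j + 1)) : cup t j ≫ whisker x ∈ monoSpan t (k + 1) j :=
  map_mem_of_mono unbend (fun w => mono_mem w.down) hx

/-- The counit dots and caps at any position. -/
inductive IsLowering : ∀ {m n : ℕ}, ((⟨m⟩ : Motzkin t) ⟶ ⟨n⟩) → Prop
  | counitDot (a : ℕ) : IsLowering (counitDot t a)
  | cap (a : ℕ) : IsLowering (cap t a)
  | whisker {m n : ℕ} {f : (⟨m⟩ : Motzkin t) ⟶ ⟨n⟩} : IsLowering f → IsLowering (whisker f)

/-- The unit dots and cups at any position. -/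
inductive IsRaising : ∀ {m n : ℕ}, ((⟨m⟩ : Motzkin t) ⟶ ⟨n⟩) → Prop
  | unitDot (a : ℕ) : IsRaising (unitDot t a)
  | cup (a : ℕ) : IsRaising (cup t a)
  | whisker {m n : ℕ} {f : (⟨m⟩ : Motzkin t) ⟶ ⟨n⟩} : IsRaising f → IsRaising (whisker f)

/-- A lowering morphism changes a step of the path. A counit dot on the strand of the last up step
makes it level, and a cap on that strand makes it a down step. Past a last level or down step, `f`
slides towards the earlier steps. -/
theorem epi_comp_lowering {k m : ℕ} (w : MotzkinPath k m) :
    ∀ {n : ℕ} {f : (⟨m⟩ : Motzkin t) ⟶ ⟨n⟩}, IsLowering f → w.epi t ≫ f ∈ epiSpan t k n := by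
  induction w with
  | nil => intro n f hf; cases hf
  | level w ih =>
    intro n f hf
    rw [epi, Category.assoc]
    exact counitDot_comp_mem (ih hf)
  | up w ih =>
    intro n f hf
    rw [epi]
    cases hf with
    | counitDot =>
      rw [whisker_counitDot]
      exact counitDot_comp_mem (epi_mem w)
    | cap => exact bend_mem_epiSpan (epi_mem w)
    | whisker hf =>
      rw [← whisker_comp]
      exact whisker_mem_epiSpan (ih hf)
  | down w ih =>
    intro n f hf
    -- The shorter path `w` has one more open strand, so `f` meets it as `whisker f`. This is why
    -- `IsLowering` is closed under whiskering.
    rw [epi, Category.assoc, ← whisker_cap, ← Category.assoc, ← whisker_comp]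
    exact bend_mem_epiSpan (ih hf.whisker)

/-- The horizontal mirror image of `epi_comp_lowering`. -/
theorem raising_comp_mono {k n : ℕ} (v : MotzkinPath k n) :
    ∀ {m : ℕ} {f : (⟨m⟩ : Motzkin t) ⟶ ⟨n⟩}, IsRaising f → f ≫ v.mono t ∈ monoSpan t k m := by
  induction v with
  | nil => intro n f hf; cases hf
  | level w ih =>
    intro n f hf
    rw [mono, ← Category.assoc]
    exact comp_unitDot_mem (ih hf)
  | up w ih =>
    intro n f hf
    rw [mono]
    cases hf with
    | unitDot =>
      rw [unitDot_whisker]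
      exact comp_unitDot_mem (mono_mem w)
    | cup => exact unbend_mem_monoSpan (mono_mem w)
    | whisker hf =>
      rw [← whisker_comp]
      exact whisker_mem_monoSpan (ih hf)
  | down w ih =>
    intro n f hf
    rw [mono, ← Category.assoc, ← cup_whisker, Category.assoc, ← whisker_comp]
    exact unbend_mem_monoSpan (ih hf.whisker)

theorem comp_mem_factorSpan {n j h : ℕ} {x : (⟨n⟩ : Motzkin t) ⟶ ⟨j⟩} {y : (⟨j⟩ : Motzkin t) ⟶ ⟨h⟩}
    (hx : x ∈ epiSpan t n j) (hy : y ∈ monoSpan t h j) : x ≫ y ∈ factorSpan t n h := by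
  refine map_mem_of_epi (Linear.rightComp 𝕜 _ y) (fun w => ?_) hx
  refine map_mem_of_mono (Linear.leftComp 𝕜 _ (w.epi t)) (fun v => ?_) hy
  exact Submodule.subset_span ⟨j, w, v, rfl⟩

theorem map_mem_of_factor {n h n' h' : ℕ}
    (F : ((⟨n⟩ : Motzkin t) ⟶ ⟨h⟩) →ₗ[𝕜] ((⟨n'⟩ : Motzkin t) ⟶ ⟨h'⟩))
    {S : Submodule 𝕜 ((⟨n'⟩ : Motzkin t) ⟶ ⟨h'⟩)}
    (H : ∀ {j : ℕ} (w : MotzkinPath n j) (v : MotzkinPath h j), F (w.epi t ≫ v.mono t) ∈ S)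
    {x : (⟨n⟩ : Motzkin t) ⟶ ⟨h⟩} (hx : x ∈ factorSpan t n h) : F x ∈ S := by
  refine (Submodule.span_le (p := S.comap F)).2 ?_ hx
  rintro _ ⟨j, w, v, rfl⟩
  exact H w v

/-- Bending moves the last step of `v` to the end of `w`: level steps stay level, and up and down
steps are exchanged. -/
theorem bend_mem_factorSpan {n h : ℕ} {x : (⟨n⟩ : Motzkin t) ⟶ ⟨h + 1⟩}
    (hx : x ∈ factorSpan t n (h + 1)) : bend x ∈ factorSpan t (n + 1) h := by
  refine map_mem_of_factor (Linear.rightComp 𝕜 _ (cap t h) ∘ₗ whisker) (fun w v => ?_) hx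
  change bend (w.epi t ≫ v.mono t) ∈ _
  cases v with
  | level v =>
    rw [mono, bend, ← Category.assoc, whisker_comp, Category.assoc, whisker_unitDot_cap,
      whisker_counitDot, ← Category.assoc]
    exact comp_mem_factorSpan (epi_mem w.level) (mono_mem v)
  | up v =>
    rw [mono, bend, whisker_comp, Category.assoc, whisker_cap, ← Category.assoc]
    exact comp_mem_factorSpan (epi_mem w.down) (mono_mem v)
  | down v =>
    rw [mono, ← Category.assoc, ← cup_whisker, Category.assoc, ← whisker_comp, ← unbend_apply,
      bend_unbend]
    exact comp_mem_factorSpan (epi_mem w.up) (mono_mem v)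

/-- The move opposite to that of `bend_mem_factorSpan`: the last step of `w` goes to the end of `v`.
-/
theorem unbend_mem_factorSpan {n h : ℕ} {x : (⟨n + 1⟩ : Motzkin t) ⟶ ⟨h⟩}
    (hx : x ∈ factorSpan t (n + 1) h) : unbend x ∈ factorSpan t n (h + 1) := by
  refine map_mem_of_factor unbend (fun w v => ?_) hx
  cases w with
  | level w =>
    rw [epi, unbend_apply, Category.assoc, whisker_comp, ← Category.assoc, cup_whisker_counitDot,
      unitDot_whisker, Category.assoc]
    exact comp_mem_factorSpan (epi_mem w) (mono_mem v.level)
  | up w =>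
    rw [epi, unbend_apply, whisker_comp, ← Category.assoc, cup_whisker, Category.assoc]
    exact comp_mem_factorSpan (epi_mem w) (mono_mem v.down)
  | down w =>
    rw [epi, Category.assoc, ← whisker_cap, ← Category.assoc, ← whisker_comp]
    change unbend (bend _) ∈ _
    rw [unbend_bend]
    exact comp_mem_factorSpan (epi_mem w) (mono_mem v.up)

/-- The dot meets the last step of `w`. A level step closes it to the scalar `t`, an up step lets it
slide into the mono part as a raising morphism, and a down step turns it into a counit dot, which
lowers the rest of the path. -/
theorem unitDot_epi_comp_mem {n j h : ℕ} (w : MotzkinPath (n + 1) j)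
    (v : MotzkinPath h j) : unitDot t n ≫ w.epi t ≫ v.mono t ∈ factorSpan t n h := by
  cases w with
  | level w =>
    rw [epi, Category.assoc, ← Category.assoc, unitDot_counitDot, Linear.smul_comp,
      Category.id_comp]
    exact Submodule.smul_mem _ _ (comp_mem_factorSpan (epi_mem w) (mono_mem v))
  | up w =>
    rw [epi, ← Category.assoc, unitDot_whisker, Category.assoc]
    exact comp_mem_factorSpan (epi_mem w) (raising_comp_mono v (.unitDot _))
  | down w =>
    rw [epi, ← Category.assoc, ← Category.assoc, unitDot_whisker, Category.assoc _ _ (cap t j),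
      unitDot_cap]
    exact comp_mem_factorSpan (epi_comp_lowering w (.counitDot _)) (mono_mem v)

/-- The cup meets the last two steps of `w`. A last level step leaves a unit dot. Otherwise, with
the steps in the order of the path: up-down gives a closed loop, hence `t`, and down-up straightens
to the identity; level-up and up-up raise the mono part; level-down and down-down lower the rest of
the epi part. -/
theorem cup_epi_comp_mem {n j h : ℕ} (w : MotzkinPath (n + 1 + 1) j) (v : MotzkinPath h j) :
    cup t n ≫ w.epi t ≫ v.mono t ∈ factorSpan t n h := by
  cases w with
  | level w =>
    rw [epi, Category.assoc, ← Category.assoc, cup_counitDot]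
    exact unitDot_epi_comp_mem w v
  | up w =>
    rw [epi]
    cases w with
    | level w =>
      rw [epi, whisker_comp, Category.assoc, ← Category.assoc, cup_whisker_counitDot,
        ← Category.assoc, unitDot_whisker, Category.assoc]
      exact comp_mem_factorSpan (epi_mem w) (raising_comp_mono v (.unitDot _))
    | up w =>
      rw [epi, ← Category.assoc, cup_whisker, Category.assoc]
      exact comp_mem_factorSpan (epi_mem w) (raising_comp_mono v (.cup _))
    | down w =>
      rw [epi, whisker_comp, ← Category.assoc, ← Category.assoc, cup_whisker,
        Category.assoc _ _ (whisker (cap t _)), cup_whisker_cap, Category.comp_id]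
      exact comp_mem_factorSpan (epi_mem w) (mono_mem v)
  | down w =>
    rw [epi, ← Category.assoc, ← Category.assoc]
    refine comp_mem_factorSpan ?_ (mono_mem v)
    cases w with
    | level w =>
      rw [epi, whisker_comp, ← Category.assoc, cup_whisker_counitDot, unitDot_whisker,
        Category.assoc, unitDot_cap]
      exact epi_comp_lowering w (.counitDot _)
    | up w =>
      rw [epi, cup_whisker, Category.assoc, cup_cap, Linear.comp_smul, Category.comp_id]
      exact Submodule.smul_mem _ _ (epi_mem w)
    | down w =>
      rw [epi, whisker_comp, ← Category.assoc, cup_whisker, Category.assoc (w.epi t),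
        cup_whisker_cap, Category.comp_id]
      exact epi_comp_lowering w (.cap _)

variable (t) in
/-- The morphisms that preserve the spans of factored morphisms under precomposition. -/
def stabilizer (m n : ℕ) : Submodule 𝕜 ((⟨m⟩ : Motzkin t) ⟶ ⟨n⟩) where
  carrier := {f | ∀ (h : ℕ) (x : (⟨n⟩ : Motzkin t) ⟶ ⟨h⟩), x ∈ factorSpan t n h →
    f ≫ x ∈ factorSpan t m h}
  add_mem' hf hg h x hx := by
    rw [Preadditive.add_comp]
    exact add_mem (hf h x hx) (hg h x hx)
  zero_mem' h x _ := by
    rw [Limits.zero_comp]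
    exact zero_mem _
  smul_mem' a f hf h x hx := by
    rw [Linear.smul_comp]
    exact Submodule.smul_mem _ a (hf h x hx)

theorem mem_stabilizer {m n : ℕ} (f : (⟨m⟩ : Motzkin t) ⟶ ⟨n⟩) : f ∈ stabilizer t m n := by
  refine mem_of_closed (stabilizer t) ?_ ?_ ?_ ?_ f
  · intro n h x hx
    rwa [Category.id_comp]
  · intro k l m f g hf hg h x hx
    rw [Category.assoc]
    exact hf h _ (hg h x hx)
  · intro k l f hf h x hx
    -- Bending is natural in the source: `whisker f ≫ x` is the bend of `f ≫ unbend x`, so the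
    -- condition on `f` suffices.
    have := bend_mem_factorSpan (hf _ _ (unbend_mem_factorSpan hx))
    rwa [bend, whisker_comp, Category.assoc, ← bend, bend_unbend] at this
  · intro a k l g h x hx
    cases g with
    | d =>
      refine map_mem_of_factor (Linear.leftComp 𝕜 _ (cap t a)) (fun w v => ?_) hx
      change cap t a ≫ w.epi t ≫ v.mono t ∈ _
      -- A cap below a path slides to its end, where it adds an up step followed by a down step.
      rw [← Category.assoc, ← whisker_cap]
      exact comp_mem_factorSpan (epi_mem w.up.down) (mono_mem v)
    | c => exact map_mem_of_factor (Linear.leftComp 𝕜 _ (cup t a)) cup_epi_comp_mem hx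
    | η => exact map_mem_of_factor (Linear.leftComp 𝕜 _ (unitDot t a)) unitDot_epi_comp_mem hx
    | ε =>
      refine map_mem_of_factor (Linear.leftComp 𝕜 _ (counitDot t a)) (fun w v => ?_) hx
      change counitDot t a ≫ w.epi t ≫ v.mono t ∈ _
      rw [← Category.assoc]
      exact comp_mem_factorSpan (epi_mem w.level) (mono_mem v)

/-- The morphisms of Motzkin paths span the morphisms to the unit object. -/
theorem epiSpan_zero (n : ℕ) : epiSpan t n 0 = ⊤ := by
  rw [eq_top_iff]
  intro f _
  have h0 : 𝟙 (⟨0⟩ : Motzkin t) ∈ factorSpan t 0 0 :=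
    Submodule.subset_span ⟨0, nil, nil, Category.id_comp _⟩
  have h := mem_stabilizer f 0 _ h0
  rw [Category.comp_id] at h
  refine map_mem_of_factor LinearMap.id (fun w v => ?_) h
  -- A path of length `0` is `nil`, so the mono part is the identity and the middle height is `0`.
  cases v
  rw [mono, Category.comp_id]
  exact epi_mem w

end MotzkinPath

/-! ### Stacks of juxtaposed partitions -/

section SumSetoid

/-- The disjoint union of two equivalence relations. -/
def sumSetoid {X Y : Type} (r : Setoid X) (s : Setoid Y) : Setoid (X ⊕ Y) where
  r := Sum.LiftRel r s
  iseqv :=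
    { refl := by
        rintro (x | x)
        · exact Sum.LiftRel.inl (r.refl x)
        · exact Sum.LiftRel.inr (s.refl x)
      symm := by
        rintro _ _ (h | h)
        · exact Sum.LiftRel.inl (r.symm h)
        · exact Sum.LiftRel.inr (s.symm h)
      trans := by
        rintro _ _ _ (h | h) (h' | h')
        · exact Sum.LiftRel.inl (r.trans h h')
        · exact Sum.LiftRel.inr (s.trans h h') }

@[simp]
theorem sumSetoid_inl_inl {X Y : Type} {r : Setoid X} {s : Setoid Y} {x y : X} :
    sumSetoid r s (Sum.inl x) (Sum.inl y) ↔ r x y := Sum.liftRel_inl_inl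

@[simp]
theorem sumSetoid_inr_inr {X Y : Type} {r : Setoid X} {s : Setoid Y} {x y : Y} :
    sumSetoid r s (Sum.inr x) (Sum.inr y) ↔ s x y := Sum.liftRel_inr_inr

@[simp]
theorem not_sumSetoid_inl_inr {X Y : Type} {r : Setoid X} {s : Setoid Y} {x : X} {y : Y} :
    ¬ sumSetoid r s (Sum.inl x) (Sum.inr y) := Sum.not_liftRel_inl_inr

@[simp]
theorem not_sumSetoid_inr_inl {X Y : Type} {r : Setoid X} {s : Setoid Y} {x : X} {y : Y} :
    ¬ sumSetoid r s (Sum.inr y) (Sum.inl x) := Sum.not_liftRel_inr_inl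

/-- Gluing commutes with disjoint unions: no generating pair joins the two summands, and inside each
summand the relation is generated by the pairs lying there. The bijections account for the
interleaved order of the vertices in a juxtaposition. -/
theorem glue_sum {V V₁ V₂ X X₁ X₂ Y Y₁ Y₂ : Type} (e : V ≃ V₁ ⊕ V₂) (eX : X ≃ X₁ ⊕ X₂)
    (eY : Y ≃ Y₁ ⊕ Y₂) (f : X → V) (f₁ : X₁ → V₁) (f₂ : X₂ → V₂) (g : Y → V) (g₁ : Y₁ → V₁)
    (g₂ : Y₂ → V₂) (hf : ∀ x, e (f x) = Sum.map f₁ f₂ (eX x))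
    (hg : ∀ y, e (g y) = Sum.map g₁ g₂ (eY y)) (r₁ : Setoid X₁) (r₂ : Setoid X₂)
    (s₁ : Setoid Y₁) (s₂ : Setoid Y₂) :
    glue f ((sumSetoid r₁ r₂).comap eX) g ((sumSetoid s₁ s₂).comap eY) =
      (sumSetoid (glue f₁ r₁ g₁ s₁) (glue f₂ r₂ g₂ s₂)).comap e := by
  apply le_antisymm
  · intro x y
    refine glue_le ?_ ?_ x y
    · intro a b h
      change sumSetoid _ _ (e (f a)) (e (f b))
      rw [hf, hf]
      rw [Setoid.comap_rel] at h
      generalize eX a = a' at h ⊢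
      generalize eX b = b' at h ⊢
      rcases h with h | h
      · exact Sum.LiftRel.inl (glue_left _ _ _ h)
      · exact Sum.LiftRel.inr (glue_left _ _ _ h)
    · intro a b h
      change sumSetoid _ _ (e (g a)) (e (g b))
      rw [hg, hg]
      rw [Setoid.comap_rel] at h
      generalize eY a = a' at h ⊢
      generalize eY b = b' at h ⊢
      rcases h with h | h
      · exact Sum.LiftRel.inl (glue_right _ _ _ h)
      · exact Sum.LiftRel.inr (glue_right _ _ _ h)
  · have hf' : ∀ x, e.symm (Sum.map f₁ f₂ x) = f (eX.symm x) := by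
      intro x
      rw [Equiv.symm_apply_eq, hf, Equiv.apply_symm_apply]
    have hg' : ∀ x, e.symm (Sum.map g₁ g₂ x) = g (eY.symm x) := by
      intro x
      rw [Equiv.symm_apply_eq, hg, Equiv.apply_symm_apply]
    set S := glue f ((sumSetoid r₁ r₂).comap eX) g ((sumSetoid s₁ s₂).comap eY) with hS
    have hL : ∀ x y, glue f₁ r₁ g₁ s₁ x y → S.comap (e.symm ∘ Sum.inl) x y := by
      refine glue_le ?_ ?_
      · intro a b h
        have := glue_left f g ((sumSetoid s₁ s₂).comap eY) (r := (sumSetoid r₁ r₂).comap eX)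
          (a := eX.symm (Sum.inl a)) (b := eX.symm (Sum.inl b)) (by simpa [Setoid.comap_rel])
        rwa [← hf', ← hf'] at this
      · intro a b h
        have := glue_right f ((sumSetoid r₁ r₂).comap eX) g (s := (sumSetoid s₁ s₂).comap eY)
          (a := eY.symm (Sum.inl a)) (b := eY.symm (Sum.inl b)) (by simpa [Setoid.comap_rel])
        rwa [← hg', ← hg'] at this
    have hR : ∀ x y, glue f₂ r₂ g₂ s₂ x y → S.comap (e.symm ∘ Sum.inr) x y := by
      refine glue_le ?_ ?_
      · intro a b h
        have := glue_left f g ((sumSetoid s₁ s₂).comap eY) (r := (sumSetoid r₁ r₂).comap eX)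
          (a := eX.symm (Sum.inr a)) (b := eX.symm (Sum.inr b)) (by simpa [Setoid.comap_rel])
        rwa [← hf', ← hf'] at this
      · intro a b h
        have := glue_right f ((sumSetoid r₁ r₂).comap eX) g (s := (sumSetoid s₁ s₂).comap eY)
          (a := eY.symm (Sum.inr a)) (b := eY.symm (Sum.inr b)) (by simpa [Setoid.comap_rel])
        rwa [← hg', ← hg'] at this
    intro x y h
    obtain ⟨x, rfl⟩ := e.symm.surjective x
    obtain ⟨y, rfl⟩ := e.symm.surjective y
    rw [Setoid.comap_rel, Equiv.apply_symm_apply, Equiv.apply_symm_apply] at h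
    rcases h with h | h
    · exact hL _ _ h
    · exact hR _ _ h

theorem ncard_classes_comap {V W : Type} (e : V ≃ W) (S : Setoid W) (Z : Set W) :
    {c ∈ (S.comap e).classes | c ⊆ e ⁻¹' Z}.ncard = {c ∈ S.classes | c ⊆ Z}.ncard := by
  refine Set.ncard_congr (fun c _ => e '' c) ?_ ?_ ?_
  · rintro _ ⟨⟨v, rfl⟩, h⟩
    refine ⟨⟨e v, ?_⟩, Set.image_subset_iff.2 h⟩
    ext w
    obtain ⟨w, rfl⟩ := e.surjective w
    simp [Setoid.comap_rel]
  · intro c c' _ _ h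
    exact e.injective.image_injective h
  · rintro _ ⟨⟨w, rfl⟩, h⟩
    refine ⟨e ⁻¹' {x | S x w}, ⟨⟨e.symm w, ?_⟩, Set.preimage_mono h⟩, ?_⟩
    · ext v
      simp [Setoid.comap_rel]
    · exact Set.image_preimage_eq _ e.surjective

/-- Each class of a disjoint union lies in one summand and is a class there. This makes the number
of closed components additive. -/
theorem ncard_classes_sum {V W : Type} [Finite V] [Finite W] (S : Setoid V) (T : Setoid W)
    (Z : Set (V ⊕ W)) :
    {c ∈ (sumSetoid S T).classes | c ⊆ Z}.ncard =
      {c ∈ S.classes | c ⊆ Sum.inl ⁻¹' Z}.ncard + {c ∈ T.classes | c ⊆ Sum.inr ⁻¹' Z}.ncard := by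
  have hl : ∀ v, {x | sumSetoid S T x (Sum.inl v)} = Sum.inl '' {x | S x v} := by
    intro v
    ext (x | x) <;> simp
  have hr : ∀ v, {x | sumSetoid S T x (Sum.inr v)} = Sum.inr '' {x | T x v} := by
    intro v
    ext (x | x) <;> simp
  have h : {c ∈ (sumSetoid S T).classes | c ⊆ Z} =
      Set.image Sum.inl '' {c ∈ S.classes | c ⊆ Sum.inl ⁻¹' Z} ∪
        Set.image Sum.inr '' {c ∈ T.classes | c ⊆ Sum.inr ⁻¹' Z} := by
    ext c
    constructor
    · rintro ⟨⟨v | v, rfl⟩, h⟩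
      · rw [hl] at h
        exact Or.inl ⟨_, ⟨⟨v, rfl⟩, Set.image_subset_iff.1 h⟩, (hl v).symm⟩
      · rw [hr] at h
        exact Or.inr ⟨_, ⟨⟨v, rfl⟩, Set.image_subset_iff.1 h⟩, (hr v).symm⟩
    · rintro (⟨_, ⟨⟨v, rfl⟩, h⟩, rfl⟩ | ⟨_, ⟨⟨v, rfl⟩, h⟩, rfl⟩)
      · exact ⟨⟨Sum.inl v, (hl v).symm⟩, Set.image_subset_iff.2 h⟩
      · exact ⟨⟨Sum.inr v, (hr v).symm⟩, Set.image_subset_iff.2 h⟩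
  rw [h, Set.ncard_union_eq ?_ (Set.toFinite _) (Set.toFinite _),
    Set.ncard_image_of_injective _ Sum.inl_injective.image_injective,
    Set.ncard_image_of_injective _ Sum.inr_injective.image_injective]
  rw [Set.disjoint_left]
  rintro _ ⟨_, ⟨⟨v, rfl⟩, _⟩, rfl⟩ ⟨c, ⟨_, _⟩, h⟩
  have h1 : (Sum.inl v : V ⊕ W) ∈ Sum.inl '' {x | S x v} := ⟨v, S.refl v, rfl⟩
  rw [← h] at h1
  obtain ⟨_, _, h2⟩ := h1
  cases h2

end SumSetoid

section StackEq

variable {A B C X : Type}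

/-- A way to compute a stack: contract it along `F`, with section `s`. -/
theorem stack_eq_comap {p : Setoid (B ⊕ C)} {q : Setoid (A ⊕ B)} (F : A ⊕ B ⊕ C → X)
    (s : X → A ⊕ B ⊕ C) (r : Setoid X)
    (hq : ∀ a b, q a b → r (F (Sum.map id Sum.inl a)) (F (Sum.map id Sum.inl b)))
    (hp : ∀ a b, p a b → r (F (Sum.inr a)) (F (Sum.inr b)))
    (hs : ∀ v, stack p q v (s (F v))) (hr : ∀ x y, r x y → stack p q (s x) (s y)) :
    stack p q = r.comap F := by
  apply le_antisymm
  · intro x y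
    exact glue_le (T := r.comap F) hq hp x y
  · intro x y h
    exact (stack p q).trans (hs x) ((stack p q).trans (hr _ _ h) ((stack p q).symm (hs y)))

theorem middleCount_eq_zero [Finite A] [Finite B] [Finite C] {p : Setoid (B ⊕ C)}
    {q : Setoid (A ⊕ B)}
    (h : ∀ b, ∃ o : A ⊕ C, stack p q (Sum.map id Sum.inr o) (Sum.inr (Sum.inl b))) :
    middleCount p q = 0 := by
  rw [middleCount, Set.ncard_eq_zero (Set.toFinite _), Set.eq_empty_iff_forall_notMem]
  rintro c ⟨⟨v, rfl⟩, hc⟩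
  obtain ⟨b, rfl⟩ := hc ((stack p q).refl v)
  obtain ⟨o, ho⟩ := h b
  obtain ⟨b', hb'⟩ := hc ho
  rcases o with o | o <;> simp at hb'

/-- With empty outer rows, the unique component is a closed one; this is the factor `t` in the
relations for `d ∘ c` and `ε ∘ η`. -/
theorem middleCount_eq_one [IsEmpty A] [Nonempty B] [IsEmpty C] {p : Setoid (B ⊕ C)}
    {q : Setoid (A ⊕ B)} (h : ∀ x y, stack p q x y) : middleCount p q = 1 := by
  rw [middleCount, Set.ncard_eq_one]
  refine ⟨Set.univ, ?_⟩
  have hu : ∀ v, {x | stack p q x v} = Set.univ := fun v => Set.eq_univ_of_forall fun x => h x v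
  ext c
  constructor
  · rintro ⟨⟨v, rfl⟩, _⟩
    exact hu v
  · rintro rfl
    obtain ⟨b⟩ := ‹Nonempty B›
    refine ⟨⟨Sum.inr (Sum.inl b), (hu _).symm⟩, ?_⟩
    rintro (a | b | c) _
    · exact isEmptyElim a
    · exact ⟨b, rfl⟩
    · exact isEmptyElim c

end StackEq

/-! ### Juxtaposition of partitions -/

namespace Partition

variable {k l k' l' : ℕ}

/-- The vertices of the left part of a juxtaposition. -/
def left (k' l' : ℕ) : Fin k ⊕ Fin l → Fin (k + k') ⊕ Fin (l + l') :=
  Sum.map (Fin.castAdd k') (Fin.castAdd l')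

/-- The vertices of the right part of a juxtaposition. -/
def right (k l : ℕ) : Fin k' ⊕ Fin l' → Fin (k + k') ⊕ Fin (l + l') :=
  Sum.map (Fin.natAdd k) (Fin.natAdd l)

/-- The two parts of a juxtaposition. -/
def splitEquiv (k l k' l' : ℕ) :
    Fin (k + k') ⊕ Fin (l + l') ≃ (Fin k ⊕ Fin l) ⊕ (Fin k' ⊕ Fin l') :=
  (Equiv.sumCongr finSumFinEquiv.symm finSumFinEquiv.symm).trans
    (Equiv.sumSumSumComm (Fin k) (Fin k') (Fin l) (Fin l'))

theorem tensor_eq (p : Partition k l) (q : Partition k' l') :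
    p.tensor q = (sumSetoid p q).comap (splitEquiv k l k' l') := rfl

@[simp]
theorem splitEquiv_left (x : Fin k ⊕ Fin l) :
    splitEquiv k l k' l' (left k' l' x) = Sum.inl x := by
  rcases x with x | x <;> simp [splitEquiv, left]

@[simp]
theorem splitEquiv_right (x : Fin k' ⊕ Fin l') :
    splitEquiv k l k' l' (right k l x) = Sum.inr x := by
  rcases x with x | x <;> simp [splitEquiv, right]

theorem left_or_right (x : Fin (k + k') ⊕ Fin (l + l')) :
    (∃ y, x = left k' l' y) ∨ ∃ y, x = right k l y := by
  rcases h : splitEquiv k l k' l' x with y | y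
  · exact Or.inl ⟨y, (splitEquiv k l k' l').injective (by rw [h, splitEquiv_left])⟩
  · exact Or.inr ⟨y, (splitEquiv k l k' l').injective (by rw [h, splitEquiv_right])⟩

variable {p : Partition k l} {q : Partition k' l'}

@[simp]
theorem tensor_left_left {x y : Fin k ⊕ Fin l} :
    p.tensor q (left k' l' x) (left k' l' y) ↔ p x y := by
  rw [tensor_eq, Setoid.comap_rel, splitEquiv_left, splitEquiv_left, sumSetoid_inl_inl]

@[simp]
theorem tensor_right_right {x y : Fin k' ⊕ Fin l'} :
    p.tensor q (right k l x) (right k l y) ↔ q x y := by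
  rw [tensor_eq, Setoid.comap_rel, splitEquiv_right, splitEquiv_right, sumSetoid_inr_inr]

@[simp]
theorem not_tensor_left_right {x : Fin k ⊕ Fin l} {y : Fin k' ⊕ Fin l'} :
    ¬ p.tensor q (left k' l' x) (right k l y) := by
  rw [tensor_eq, Setoid.comap_rel, splitEquiv_left, splitEquiv_right]
  exact not_sumSetoid_inl_inr

@[simp]
theorem not_tensor_right_left {x : Fin k ⊕ Fin l} {y : Fin k' ⊕ Fin l'} :
    ¬ p.tensor q (right k l y) (left k' l' x) := by
  rw [tensor_eq, Setoid.comap_rel, splitEquiv_left, splitEquiv_right]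
  exact not_sumSetoid_inr_inl

theorem tensor_id (k l : ℕ) :
    Partition.tensor (idSetoid (Fin k)) (idSetoid (Fin l)) = idSetoid (Fin (k + l)) := by
  have hid : ∀ (n : ℕ) (x y : Fin n ⊕ Fin n),
      idSetoid (Fin n) x y ↔ Sum.elim id id x = Sum.elim id id y := fun _ _ _ => Iff.rfl
  have hl : ∀ x : Fin k ⊕ Fin k, Sum.elim id id (left l l x) = Fin.castAdd l (Sum.elim id id x) := by
    rintro (x | x) <;> rfl
  have hr : ∀ x : Fin l ⊕ Fin l, Sum.elim id id (right k k x) = Fin.natAdd k (Sum.elim id id x) := by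
    rintro (x | x) <;> rfl
  have hne : ∀ (i : Fin k) (j : Fin l), Fin.castAdd l i ≠ Fin.natAdd k j := by
    intro i j h
    have := congrArg Fin.val h
    simp only [Fin.val_castAdd, Fin.val_natAdd] at this
    omega
  ext x y
  rcases left_or_right x with ⟨x, rfl⟩ | ⟨x, rfl⟩ <;>
    rcases left_or_right y with ⟨y, rfl⟩ | ⟨y, rfl⟩
  · rw [tensor_left_left, hid, hid, hl, hl, (Fin.castAdd_injective k l).eq_iff]
  · simp [hid, hl, hr, hne]
  · simp [hid, hl, hr, (hne _ _).symm]
  · rw [tensor_right_right, hid, hid, hr, hr, (Fin.natAdd_injective l k).eq_iff]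

/-- Transport of a partition along equalities of its numbers of vertices. -/
@[reducible]
def cast (hk : k = k') (hl : l = l') (p : Partition k l) : Partition k' l' :=
  p.comap (Sum.map (Fin.cast hk.symm) (Fin.cast hl.symm))

theorem cast_rfl (p : Partition k l) : cast rfl rfl p = p := by
  ext x y
  rcases x with x | x <;> rcases y with y | y <;> rfl

/-- Every vertex lies in exactly one of the three parts, and the relabelling preserves the part and
the position in it; the nine cases follow. -/
theorem tensor_assoc {k'' l'' : ℕ} (p : Partition k l) (q : Partition k' l')
    (r : Partition k'' l'') :
    cast (Nat.add_assoc k k' k'') (Nat.add_assoc l l' l'') ((p.tensor q).tensor r) =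
      p.tensor (q.tensor r) := by
  have h1 : ∀ x : Fin k ⊕ Fin l, Sum.map (Fin.cast (Nat.add_assoc k k' k'').symm)
      (Fin.cast (Nat.add_assoc l l' l'').symm) (left (k' + k'') (l' + l'') x) =
      left k'' l'' (left k' l' x) := by
    rintro (x | x) <;> rfl
  have h2 : ∀ x : Fin k' ⊕ Fin l', Sum.map (Fin.cast (Nat.add_assoc k k' k'').symm)
      (Fin.cast (Nat.add_assoc l l' l'').symm) (right k l (left k'' l'' x)) =
      left k'' l'' (right k l x) := by
    rintro (x | x) <;> rfl
  have h3 : ∀ x : Fin k'' ⊕ Fin l'', Sum.map (Fin.cast (Nat.add_assoc k k' k'').symm)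
      (Fin.cast (Nat.add_assoc l l' l'').symm) (right k l (right k' l' x)) =
      right (k + k') (l + l') x := by
    rintro (x | x) <;> simp [right, Fin.ext_iff, Nat.add_assoc]
  ext x y
  rw [cast, Setoid.comap_rel]
  rcases left_or_right x with ⟨x, rfl⟩ | ⟨x, rfl⟩
  on_goal 2 => rcases left_or_right x with ⟨x, rfl⟩ | ⟨x, rfl⟩
  all_goals
    rcases left_or_right y with ⟨y, rfl⟩ | ⟨y, rfl⟩
    on_goal 2 => rcases left_or_right y with ⟨y, rfl⟩ | ⟨y, rfl⟩
  all_goals simp only [h1, h2, h3, tensor_left_left, tensor_right_right, not_tensor_left_right,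
    not_tensor_right_left]

theorem id_zero_tensor (p : Partition k l) :
    cast (Nat.zero_add k) (Nat.zero_add l) (Partition.tensor (idSetoid (Fin 0)) p) = p := by
  have h : ∀ x : Fin k ⊕ Fin l, Sum.map (Fin.cast (Nat.zero_add k).symm)
      (Fin.cast (Nat.zero_add l).symm) x = right 0 0 x := by
    rintro (x | x) <;> simp [right]
  ext x y
  rw [cast, Setoid.comap_rel, h, h, tensor_right_right]

theorem tensor_id_zero (p : Partition k l) :
    cast (Nat.add_zero k) (Nat.add_zero l) (Partition.tensor p (idSetoid (Fin 0))) = p := by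
  have h : ∀ x : Fin k ⊕ Fin l, Sum.map (Fin.cast (Nat.add_zero k).symm)
      (Fin.cast (Nat.add_zero l).symm) x = left 0 0 x := by
    rintro (x | x) <;> rfl
  ext x y
  rw [cast, Setoid.comap_rel, h, h, tensor_left_left]

/-- The two parts of a juxtaposition of stacks. -/
def splitEquiv₃ (k l m k' l' m' : ℕ) : Fin (k + k') ⊕ Fin (l + l') ⊕ Fin (m + m') ≃
    (Fin k ⊕ Fin l ⊕ Fin m) ⊕ (Fin k' ⊕ Fin l' ⊕ Fin m') :=
  (Equiv.sumCongr finSumFinEquiv.symm (splitEquiv l m l' m')).trans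
    (Equiv.sumSumSumComm (Fin k) (Fin k') (Fin l ⊕ Fin m) (Fin l' ⊕ Fin m'))

theorem stack_tensor {m m' : ℕ} (p : Partition l m) (q : Partition k l) (p' : Partition l' m')
    (q' : Partition k' l') : stack (p.tensor p') (q.tensor q') =
      (sumSetoid (stack p q) (stack p' q')).comap (splitEquiv₃ k l m k' l' m') := by
  refine glue_sum (splitEquiv₃ k l m k' l' m') (splitEquiv k l k' l') (splitEquiv l m l' m')
    (Sum.map id Sum.inl) (Sum.map id Sum.inl) (Sum.map id Sum.inl) Sum.inr Sum.inr Sum.inr ?_ ?_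
    q q' p p'
  · intro x
    rcases left_or_right x with ⟨x, rfl⟩ | ⟨x, rfl⟩ <;> rcases x with x | x <;>
      simp [splitEquiv₃, splitEquiv, left, right]
  · intro x
    rcases left_or_right x with ⟨x, rfl⟩ | ⟨x, rfl⟩ <;> rcases x with x | x <;>
      simp [splitEquiv₃, splitEquiv, left, right]

theorem star_tensor {m m' : ℕ} (p : Partition l m) (q : Partition k l) (p' : Partition l' m')
    (q' : Partition k' l') :
    star (p.tensor p') (q.tensor q') = Partition.tensor (star p q) (star p' q') := by
  ext x y
  rw [star, stack_tensor, Setoid.comap_rel, Setoid.comap_rel]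
  have hl : ∀ x : Fin k ⊕ Fin m, splitEquiv₃ k l m k' l' m'
      (Sum.map id Sum.inr (left k' m' x)) = Sum.inl (Sum.map id Sum.inr x) := by
    rintro (x | x) <;> simp [splitEquiv₃, splitEquiv, left]
  have hr : ∀ x : Fin k' ⊕ Fin m', splitEquiv₃ k l m k' l' m'
      (Sum.map id Sum.inr (right k m x)) = Sum.inr (Sum.map id Sum.inr x) := by
    rintro (x | x) <;> simp [splitEquiv₃, splitEquiv, right]
  rcases left_or_right x with ⟨x, rfl⟩ | ⟨x, rfl⟩ <;>
    rcases left_or_right y with ⟨y, rfl⟩ | ⟨y, rfl⟩ <;>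
    simp only [hl, hr, sumSetoid_inl_inl, sumSetoid_inr_inr, not_sumSetoid_inl_inr,
      not_sumSetoid_inr_inl, tensor_left_left, tensor_right_right, not_tensor_left_right,
      not_tensor_right_left] <;> rfl

theorem middleCount_tensor {m m' : ℕ} (p : Partition l m) (q : Partition k l)
    (p' : Partition l' m') (q' : Partition k' l') :
    middleCount (p.tensor p') (q.tensor q') = middleCount p q + middleCount p' q' := by
  -- The middle vertices of both stacks, so that closed components can be counted summand by
  -- summand.
  let Z : Set ((Fin k ⊕ Fin l ⊕ Fin m) ⊕ (Fin k' ⊕ Fin l' ⊕ Fin m')) :=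
    {v | (∃ b, Sum.inl (Sum.inr (Sum.inl b)) = v) ∨ ∃ b, Sum.inr (Sum.inr (Sum.inl b)) = v}
  have hZ : (Set.range fun b : Fin (l + l') =>
      (Sum.inr (Sum.inl b) : Fin (k + k') ⊕ Fin (l + l') ⊕ Fin (m + m'))) =
      splitEquiv₃ k l m k' l' m' ⁻¹' Z := by
    ext x
    rcases x with x | x | x <;> induction x using Fin.addCases <;>
      simp [splitEquiv₃, splitEquiv, Z]
  rw [middleCount, stack_tensor, hZ, ncard_classes_comap, ncard_classes_sum]
  congr 3
  · ext c
    have : Sum.inl ⁻¹' Z = Set.range fun b : Fin l =>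
        (Sum.inr (Sum.inl b) : Fin k ⊕ Fin l ⊕ Fin m) := by
      ext x
      simp [Z]
    rw [this]
  · ext c
    have : Sum.inr ⁻¹' Z = Set.range fun b : Fin l' =>
        (Sum.inr (Sum.inl b) : Fin k' ⊕ Fin l' ⊕ Fin m') := by
      ext x
      simp [Z]
    rw [this]

end Partition

variable {𝕜 : Type u} [CommRing 𝕜] {t : 𝕜}

/-! ### The tensor product of the partition category -/

namespace Par

theorem tensor_single {k l k' l' : ℕ} (p : Partition k l) (q : Partition k' l') (a b : 𝕜) :
    tensor (t := t) (Finsupp.single p a) (Finsupp.single q b) =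
      Finsupp.single (p.tensor q) (a * b) := by
  have h1 : tensor (t := t) (Finsupp.single p a) = a • Finsupp.lift _ 𝕜 _ fun q =>
      (Finsupp.single (Partition.tensor p q) 1 : Hom (⟨k + k'⟩ : Par t) ⟨l + l'⟩) :=
    Finsupp.sum_single_index (zero_smul _ _)
  have h2 : (Finsupp.lift _ 𝕜 _ fun q =>
      (Finsupp.single (Partition.tensor p q) 1 : Hom (⟨k + k'⟩ : Par t) ⟨l + l'⟩))
      (Finsupp.single q b) = b • Finsupp.single (Partition.tensor p q) 1 :=
    Finsupp.sum_single_index (zero_smul _ _)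
  rw [h1, LinearMap.smul_apply, h2, Finsupp.smul_single, Finsupp.smul_single, smul_eq_mul,
    smul_eq_mul, mul_one]

/-- By multilinearity only partitions matter. There `star_tensor` matches the diagrams and
`middleCount_tensor` matches the powers of `t`. -/
theorem tensor_comp {k l m k' l' m' : ℕ} (f : Hom (⟨l⟩ : Par t) ⟨m⟩) (g : Hom (⟨k⟩ : Par t) ⟨l⟩)
    (f' : Hom (⟨l'⟩ : Par t) ⟨m'⟩) (g' : Hom (⟨k'⟩ : Par t) ⟨l'⟩) :
    tensor (compBilin _ _ _ f g) (compBilin _ _ _ f' g') =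
      compBilin _ _ _ (tensor f f') (tensor g g') := by
  induction f using Finsupp.induction_linear with
  | zero => simp
  | add f₁ f₂ h₁ h₂ => simp only [map_add, LinearMap.add_apply, h₁, h₂]
  | single p a =>
  induction g using Finsupp.induction_linear with
  | zero => simp
  | add f₁ f₂ h₁ h₂ => simp only [map_add, LinearMap.add_apply, h₁, h₂]
  | single q b =>
  induction f' using Finsupp.induction_linear with
  | zero => simp
  | add f₁ f₂ h₁ h₂ => simp only [map_add, LinearMap.add_apply, h₁, h₂]
  | single p' a' =>
  induction g' using Finsupp.induction_linear with
  | zero => simp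
  | add f₁ f₂ h₁ h₂ => simp only [map_add, h₁, h₂]
  | single q' b' =>
  rw [compBilin_single, compBilin_single, tensor_single, tensor_single, tensor_single,
    compBilin_single, Partition.star_tensor, Partition.middleCount_tensor, pow_add]
  congr 1
  ring

/-- Transport of a morphism along equalities of its source and target. -/
noncomputable def cast {k l k' l' : ℕ} (hk : k = k') (hl : l = l') :
    Hom (⟨k⟩ : Par t) ⟨l⟩ →ₗ[𝕜] Hom (⟨k'⟩ : Par t) ⟨l'⟩ :=
  Finsupp.lmapDomain 𝕜 𝕜 (Partition.cast hk hl)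

theorem cast_single {k l k' l' : ℕ} (hk : k = k') (hl : l = l') (p : Partition k l) (a : 𝕜) :
    cast (t := t) hk hl (Finsupp.single p a) = Finsupp.single (Partition.cast hk hl p) a :=
  Finsupp.mapDomain_single

theorem cast_rfl {k l : ℕ} (f : Hom (⟨k⟩ : Par t) ⟨l⟩) : cast rfl rfl f = f := by
  induction f using Finsupp.induction_linear with
  | zero => simp
  | add f₁ f₂ h₁ h₂ => rw [map_add, h₁, h₂]
  | single p a => rw [cast_single, Partition.cast_rfl]

theorem tensor_assoc {k l k' l' k'' l'' : ℕ} (f : Hom (⟨k⟩ : Par t) ⟨l⟩)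
    (g : Hom (⟨k'⟩ : Par t) ⟨l'⟩) (h : Hom (⟨k''⟩ : Par t) ⟨l''⟩) :
    cast (Nat.add_assoc k k' k'') (Nat.add_assoc l l' l'') (tensor (tensor f g) h) =
      tensor f (tensor g h) := by
  induction f using Finsupp.induction_linear with
  | zero => simp
  | add f₁ f₂ h₁ h₂ => simp only [map_add, LinearMap.add_apply, h₁, h₂]
  | single p a =>
  induction g using Finsupp.induction_linear with
  | zero => simp
  | add f₁ f₂ h₁ h₂ => simp only [map_add, LinearMap.add_apply, h₁, h₂]
  | single q b =>
  induction h using Finsupp.induction_linear with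
  | zero => simp
  | add f₁ f₂ h₁ h₂ => simp only [map_add, h₁, h₂]
  | single r c =>
  rw [tensor_single, tensor_single, tensor_single, tensor_single, cast_single,
    Partition.tensor_assoc, mul_assoc]

theorem id_zero_tensor {k l : ℕ} (f : Hom (⟨k⟩ : Par t) ⟨l⟩) :
    cast (Nat.zero_add k) (Nat.zero_add l)
      (tensor (Finsupp.single (idSetoid (Fin 0)) 1 : Hom (⟨0⟩ : Par t) ⟨0⟩) f) = f := by
  induction f using Finsupp.induction_linear with
  | zero => simp
  | add f₁ f₂ h₁ h₂ => rw [map_add, map_add, h₁, h₂]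
  | single p a => rw [tensor_single, cast_single, Partition.id_zero_tensor, one_mul]

theorem tensor_id_zero {k l : ℕ} (f : Hom (⟨k⟩ : Par t) ⟨l⟩) :
    cast (Nat.add_zero k) (Nat.add_zero l)
      (tensor f (Finsupp.single (idSetoid (Fin 0)) 1 : Hom (⟨0⟩ : Par t) ⟨0⟩)) = f := by
  induction f using Finsupp.induction_linear with
  | zero => simp
  | add f₁ f₂ h₁ h₂ => rw [map_add, LinearMap.add_apply, map_add, h₁, h₂]
  | single p a => rw [tensor_single, cast_single, Partition.tensor_id_zero, mul_one]

end Par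

/-! ### The functor to the partition category -/

namespace FreeMor

variable {G : ℕ → ℕ → Type}

/-- The interpretation of expressions in the partition category that sends all generators to
one-block partitions. -/
noncomputable def toPar (t : 𝕜) : ∀ {k l : ℕ}, FreeMor 𝕜 G k l → Par.Hom (⟨k⟩ : Par t) ⟨l⟩
  | _, _, of _ => Finsupp.single ⊤ 1
  | _, _, id k => Finsupp.single (idSetoid (Fin k)) 1
  | _, _, comp f g => Par.compBilin _ _ _ (toPar t f) (toPar t g)
  | _, _, tensor f g => Par.tensor (toPar t f) (toPar t g)
  | _, _, zero => 0
  | _, _, add f g => toPar t f + toPar t g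
  | _, _, smul a f => a • toPar t f

theorem toPar_cast {k l k' l' : ℕ} (hk : k = k') (hl : l = l') (f : FreeMor 𝕜 G k l) :
    toPar t (cast hk hl f) = Par.cast hk hl (toPar t f) := by
  subst hk hl
  exact (Par.cast_rfl _).symm

/-- `MorEq` is generated by `R` and by axioms that hold in the partition category, so only the
relations in `R` need to be supplied. -/
theorem toPar_eq {R : Relations 𝕜 G}
    (hR : ∀ {k l : ℕ} {f g : FreeMor 𝕜 G k l}, R k l f g → toPar t f = toPar t g) {k l : ℕ}
    {f g : FreeMor 𝕜 G k l} (h : MorEq R f g) : toPar t f = toPar t g := by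
  induction h with
  | of_rel h => exact hR h
  | refl => rfl
  | symm _ ih => exact ih.symm
  | trans _ _ ih ih' => exact ih.trans ih'
  | comp_congr _ _ ih ih' => simp only [toPar, ih, ih']
  | tensor_congr _ _ ih ih' => simp only [toPar, ih, ih']
  | add_congr _ _ ih ih' => simp only [toPar, ih, ih']
  | smul_congr _ _ ih => simp only [toPar, ih]
  | add_assoc => exact _root_.add_assoc _ _ _
  | add_comm => exact _root_.add_comm _ _
  | zero_add => exact _root_.zero_add _
  | smul_add => exact _root_.smul_add _ _ _
  | add_smul => exact _root_.add_smul _ _ _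
  | mul_smul => exact SemigroupAction.mul_smul _ _ _
  | one_smul => exact _root_.one_smul _ _
  | zero_smul => exact _root_.zero_smul _ _
  | smul_zero => exact _root_.smul_zero _
  | id_comp f => exact Category.comp_id (X := (⟨_⟩ : Par t)) (Y := ⟨_⟩) (toPar t f)
  | comp_id f => exact Category.id_comp (X := (⟨_⟩ : Par t)) (Y := ⟨_⟩) (toPar t f)
  | comp_assoc f g h =>
    exact (Category.assoc (W := (⟨_⟩ : Par t)) (X := ⟨_⟩) (Y := ⟨_⟩) (Z := ⟨_⟩) (toPar t h)
      (toPar t g) (toPar t f)).symm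
  | add_comp => simp only [toPar, map_add, LinearMap.add_apply]
  | comp_add => simp only [toPar, map_add]
  | smul_comp => simp only [toPar, map_smul, LinearMap.smul_apply]
  | comp_smul => simp only [toPar, map_smul]
  | tensor_id => rw [toPar, toPar, toPar, toPar, Par.tensor_single, Partition.tensor_id, mul_one]
  | tensor_comp => exact Par.tensor_comp _ _ _ _
  | add_tensor => simp only [toPar, map_add, LinearMap.add_apply]
  | tensor_add => simp only [toPar, map_add]
  | smul_tensor => simp only [toPar, map_smul, LinearMap.smul_apply]
  | tensor_smul => simp only [toPar, map_smul]
  | tensor_assoc => rw [toPar_cast]; exact Par.tensor_assoc _ _ _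
  | id_tensor => rw [toPar_cast]; exact Par.id_zero_tensor _
  | tensor_id_zero => rw [toPar_cast]; exact Par.tensor_id_zero _

end FreeMor

/-! ### The defining relations hold for partitions -/

section Relations

open MotzkinCat.Partition

theorem glue_of_eq_left {V X Y : Type} {f : X → V} {r : Setoid X} {g : Y → V} {s : Setoid Y}
    {x y : V} (a b : X) (h : r a b) (hx : f a = x) (hy : f b = y) : glue f r g s x y :=
  hx ▸ hy ▸ glue_left f g s h

theorem glue_of_eq_right {V X Y : Type} {f : X → V} {r : Setoid X} {g : Y → V} {s : Setoid Y}
    {x y : V} (a b : Y) (h : s a b) (hx : g a = x) (hy : g b = y) : glue f r g s x y :=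
  hx ▸ hy ▸ glue_right f r g h

/-- The vertices of one block of the left part of a juxtaposition are joined. -/
theorem tensor_of_left {k l k' l' : ℕ} {p : Partition k l} {q : Partition k' l'}
    {x y : Fin (k + k') ⊕ Fin (l + l')} (a b : Fin k ⊕ Fin l) (h : p a b)
    (hx : left k' l' a = x) (hy : left k' l' b = y) : p.tensor q x y :=
  hx ▸ hy ▸ tensor_left_left.2 h

theorem tensor_of_right {k l k' l' : ℕ} {p : Partition k l} {q : Partition k' l'}
    {x y : Fin (k + k') ⊕ Fin (l + l')} (a b : Fin k' ⊕ Fin l') (h : q a b)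
    (hx : right k l a = x) (hy : right k l b = y) : p.tensor q x y :=
  hx ▸ hy ▸ tensor_right_right.2 h

theorem stack_connected {A B C : Type} {p : Setoid (B ⊕ C)} {q : Setoid (A ⊕ B)}
    {v : A ⊕ B ⊕ C} (h : ∀ x, stack p q v x) (x y) : stack p q x y :=
  (stack p q).trans ((stack p q).symm (h x)) (h y)

/-- A connected stack with an outer vertex `o` has no closed component and induces a single block;
this covers every relation without the scalar `t`. -/
theorem compBilin_of_connected {k l m : ℕ} {p : Partition l m} {q : Partition k l}
    (h : ∀ x y, stack p q x y) (o : Fin k ⊕ Fin m) :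
    Par.compBilin (⟨k⟩ : Par t) ⟨l⟩ ⟨m⟩ (Finsupp.single p 1) (Finsupp.single q 1) =
      Finsupp.single ⊤ 1 := by
  have h1 : star p q = ⊤ := by
    ext x y
    exact ⟨fun _ => trivial, fun _ => h _ _⟩
  have h2 : middleCount p q = 0 := middleCount_eq_zero fun b => ⟨o, h _ _⟩
  rw [Par.compBilin_single, h1, h2, pow_zero, mul_one, mul_one]

theorem compBilin_of_closed {l : ℕ} {p : Partition l 0} {q : Partition 0 l} [Nonempty (Fin l)]
    (h : ∀ x y, stack p q x y) :
    Par.compBilin (⟨0⟩ : Par t) ⟨l⟩ ⟨0⟩ (Finsupp.single p 1) (Finsupp.single q 1) =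
      t • Finsupp.single (idSetoid (Fin 0)) 1 := by
  have h1 : star p q = idSetoid (Fin 0) := by
    ext x y
    exact isEmptyElim x
  rw [Par.compBilin_single, h1, middleCount_eq_one h, pow_one, mul_one, one_mul,
    Finsupp.smul_single, smul_eq_mul, mul_one]

theorem idSetoid_one : idSetoid (Fin 1) = ⊤ := by
  ext x y
  exact ⟨fun _ => trivial, fun _ => Subsingleton.elim (α := Fin 1) _ _⟩

/-- Each stack is connected: for the relations without scalar, every vertex is joined to a chosen
middle vertex. The identity of `1` has one block (`idSetoid_one`), so the right-hand sides without
`t` are all `⊤`. -/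
theorem toPar_motzkinRel {k l : ℕ} {f g : FreeMor 𝕜 MotzkinGen k l} (h : MotzkinRel t k l f g) :
    FreeMor.toPar t f = FreeMor.toPar t g := by
  cases h <;> simp only [FreeMor.toPar] <;> try rw [Par.tensor_single, mul_one]
  case cap_dot =>
    rw [idSetoid_one]
    refine compBilin_of_connected (k := 1) (l := 2) (m := 0) (stack_connected (v := Sum.inr (Sum.inl 0)) ?_) (Sum.inl 0)
    intro x
    fin_cases x
    · exact glue_of_eq_left (Sum.inr 0) (Sum.inl 0)
        (tensor_of_left (Sum.inr 0) (Sum.inl 0) trivial rfl rfl) rfl rfl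
    · exact glue_of_eq_right (Sum.inl 0) (Sum.inl 0) trivial rfl rfl
    · exact glue_of_eq_right (Sum.inl 0) (Sum.inl 1) trivial rfl rfl
  case cap_dot_sharp =>
    rw [idSetoid_one]
    refine compBilin_of_connected (k := 1) (l := 2) (m := 0) (stack_connected (v := Sum.inr (Sum.inl 1)) ?_) (Sum.inl 0)
    intro x
    fin_cases x
    · exact glue_of_eq_left (Sum.inr 1) (Sum.inl 0)
        (tensor_of_right (Sum.inr 0) (Sum.inl 0) trivial rfl rfl) rfl rfl
    · exact glue_of_eq_right (Sum.inl 1) (Sum.inl 0) trivial rfl rfl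
    · exact glue_of_eq_right (Sum.inl 1) (Sum.inl 1) trivial rfl rfl
  case cup_dot =>
    rw [idSetoid_one]
    refine compBilin_of_connected (k := 0) (l := 2) (m := 1) (stack_connected (v := Sum.inr (Sum.inl 0)) ?_) (Sum.inr 0)
    intro x
    fin_cases x
    · exact glue_of_eq_left (Sum.inr 0) (Sum.inr 0) trivial rfl rfl
    · exact glue_of_eq_left (Sum.inr 0) (Sum.inr 1) trivial rfl rfl
    · exact glue_of_eq_right (Sum.inl 0) (Sum.inr 0)
        (tensor_of_left (Sum.inl 0) (Sum.inr 0) trivial rfl rfl) rfl rfl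
  case cup_dot_sharp =>
    rw [idSetoid_one]
    refine compBilin_of_connected (k := 0) (l := 2) (m := 1) (stack_connected (v := Sum.inr (Sum.inl 1)) ?_) (Sum.inr 0)
    intro x
    fin_cases x
    · exact glue_of_eq_left (Sum.inr 1) (Sum.inr 0) trivial rfl rfl
    · exact glue_of_eq_left (Sum.inr 1) (Sum.inr 1) trivial rfl rfl
    · exact glue_of_eq_right (Sum.inl 1) (Sum.inr 0)
        (tensor_of_right (Sum.inl 0) (Sum.inr 0) trivial rfl rfl) rfl rfl
  case zigzag =>
    rw [Par.tensor_single, mul_one, idSetoid_one]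
    refine compBilin_of_connected (k := 1) (l := 3) (m := 1) (stack_connected (v := Sum.inr (Sum.inl 1)) ?_) (Sum.inl 0)
    -- The middle vertices `1` and `0` are joined by the cap above, and `1` and `2` by the cup
    -- below. Each outer vertex is then joined to the end of its identity strand. In the reflected
    -- relation the cap and the cup change places.
    have h0 : stack (B := Fin 3) (Partition.tensor (⊤ : Partition 2 0) (⊤ : Partition 1 1))
        (Partition.tensor (⊤ : Partition 1 1) (⊤ : Partition 0 2))
        (Sum.inr (Sum.inl 1)) (Sum.inr (Sum.inl 0)) :=
      glue_of_eq_right (Sum.inl 1) (Sum.inl 0)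
        (tensor_of_left (Sum.inl 1) (Sum.inl 0) trivial rfl rfl) rfl rfl
    have h2 : stack (B := Fin 3) (Partition.tensor (⊤ : Partition 2 0) (⊤ : Partition 1 1))
        (Partition.tensor (⊤ : Partition 1 1) (⊤ : Partition 0 2))
        (Sum.inr (Sum.inl 1)) (Sum.inr (Sum.inl 2)) :=
      glue_of_eq_left (Sum.inr 1) (Sum.inr 2)
        (tensor_of_right (Sum.inr 0) (Sum.inr 1) trivial rfl rfl) rfl rfl
    intro x
    fin_cases x
    · exact Setoid.trans' _ h0 (glue_of_eq_left (Sum.inr 0) (Sum.inl 0)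
        (tensor_of_left (Sum.inr 0) (Sum.inl 0) trivial rfl rfl) rfl rfl)
    · exact h0
    · exact Setoid.refl' _ _
    · exact h2
    · exact Setoid.trans' _ h2 (glue_of_eq_right (Sum.inl 2) (Sum.inr 0)
        (tensor_of_right (Sum.inl 0) (Sum.inr 0) trivial rfl rfl) rfl rfl)
  case zigzag_sharp =>
    rw [Par.tensor_single, mul_one, idSetoid_one]
    refine compBilin_of_connected (k := 1) (l := 3) (m := 1) (stack_connected (v := Sum.inr (Sum.inl 1)) ?_) (Sum.inl 0)
    have h0 : stack (B := Fin 3) (Partition.tensor (⊤ : Partition 1 1) (⊤ : Partition 2 0))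
        (Partition.tensor (⊤ : Partition 0 2) (⊤ : Partition 1 1))
        (Sum.inr (Sum.inl 1)) (Sum.inr (Sum.inl 0)) :=
      glue_of_eq_left (Sum.inr 1) (Sum.inr 0)
        (tensor_of_left (Sum.inr 1) (Sum.inr 0) trivial rfl rfl) rfl rfl
    have h2 : stack (B := Fin 3) (Partition.tensor (⊤ : Partition 1 1) (⊤ : Partition 2 0))
        (Partition.tensor (⊤ : Partition 0 2) (⊤ : Partition 1 1))
        (Sum.inr (Sum.inl 1)) (Sum.inr (Sum.inl 2)) :=
      glue_of_eq_right (Sum.inl 1) (Sum.inl 2)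
        (tensor_of_right (Sum.inl 0) (Sum.inl 1) trivial rfl rfl) rfl rfl
    intro x
    fin_cases x
    · exact Setoid.trans' _ h2 (glue_of_eq_left (Sum.inr 2) (Sum.inl 0)
        (tensor_of_right (Sum.inr 0) (Sum.inl 0) trivial rfl rfl) rfl rfl)
    · exact h0
    · exact Setoid.refl' _ _
    · exact h2
    · exact Setoid.trans' _ h0 (glue_of_eq_right (Sum.inl 0) (Sum.inr 0)
        (tensor_of_left (Sum.inl 0) (Sum.inr 0) trivial rfl rfl) rfl rfl)
  case bubble =>
    refine compBilin_of_closed (l := 2) fun x y => ?_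
    rcases x with x | x | x
    · exact x.elim0
    · rcases y with y | y | y
      · exact y.elim0
      · exact glue_of_eq_right (Sum.inl x) (Sum.inl y) trivial rfl rfl
      · exact y.elim0
    · exact x.elim0
  case dots =>
    refine compBilin_of_closed (l := 1) fun x y => ?_
    rcases x with x | x | x
    · exact x.elim0
    · rcases y with y | y | y
      · exact y.elim0
      · exact glue_of_eq_right (Sum.inl x) (Sum.inl y) trivial rfl rfl
      · exact y.elim0
    · exact x.elim0

end Relations

/-- The functor from the Motzkin category to the partition category. -/
noncomputable def Motzkin.toPar (t : 𝕜) (k l : ℕ) :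
    ((⟨k⟩ : Motzkin t) ⟶ ⟨l⟩) →ₗ[𝕜] ((⟨k⟩ : Par t) ⟶ ⟨l⟩) where
  toFun f := Quotient.lift (s := Presented.setoid (MotzkinRel t) k l)
    (fun x => (FreeMor.toPar t x : (⟨k⟩ : Par t) ⟶ ⟨l⟩))
    (fun _ _ h => FreeMor.toPar_eq toPar_motzkinRel h) f
  map_add' := by
    rintro ⟨f⟩ ⟨g⟩
    rfl
  map_smul' := by
    rintro a ⟨f⟩
    rfl

theorem Motzkin.isDiagramFunctor_toPar (t : 𝕜) : IsDiagramFunctor t (Motzkin.toPar t) where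
  map_id _ := rfl
  map_comp := by
    rintro k l m ⟨f⟩ ⟨g⟩
    rfl
  map_tensor := by
    rintro k l k' l' ⟨f⟩ ⟨g⟩
    rfl
  map_gen _ := rfl

/-! ### Bending partitions -/

namespace Partition

/-- The relabelling of vertices that bends the last bottom vertex up. -/
def bendEquiv (k l : ℕ) : Fin k ⊕ Fin (l + 1) ≃ Fin (k + 1) ⊕ Fin l where
  toFun := Sum.elim (fun i => Sum.inl i.castSucc)
    (Fin.lastCases (Sum.inl (Fin.last k)) fun j => Sum.inr j)
  invFun := Sum.elim (Fin.lastCases (Sum.inr (Fin.last l)) fun i => Sum.inl i)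
    fun j => Sum.inr j.castSucc
  left_inv := by
    rintro (i | j)
    · simp
    · induction j using Fin.lastCases <;> simp
  right_inv := by
    rintro (i | j)
    · induction i using Fin.lastCases <;> simp
    · simp

variable {k l : ℕ}

@[simp]
theorem bendEquiv_inl (i : Fin k) : bendEquiv k l (Sum.inl i) = Sum.inl i.castSucc := rfl

@[simp]
theorem bendEquiv_inr_castSucc (j : Fin l) :
    bendEquiv k l (Sum.inr j.castSucc) = Sum.inr j := by
  simp [bendEquiv]

@[simp]
theorem bendEquiv_inr_last : bendEquiv k l (Sum.inr (Fin.last l)) = Sum.inl (Fin.last k) := by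
  simp [bendEquiv]

/-- The partition with the last bottom vertex bent up. -/
def unbend (k l : ℕ) : Partition (k + 1) l ≃ Partition k (l + 1) where
  toFun p := p.comap (bendEquiv k l)
  invFun p := p.comap (bendEquiv k l).symm
  left_inv p := by
    ext x y
    simp [Setoid.comap_rel]
  right_inv p := by
    ext x y
    simp [Setoid.comap_rel]

theorem unbend_rel {p : Partition (k + 1) l} {x y : Fin k ⊕ Fin (l + 1)} :
    unbend k l p x y ↔ p (bendEquiv k l x) (bendEquiv k l y) := Iff.rfl

theorem unbend_symm_rel {p : Partition k (l + 1)} {x y : Fin (k + 1) ⊕ Fin l} :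
    (unbend k l).symm p x y ↔ p ((bendEquiv k l).symm x) ((bendEquiv k l).symm y) := Iff.rfl

/-- The contraction of the stack of `p ⊗ 1` on top of `1_k ⊗ c`. -/
def unbendContract (k l : ℕ) : Fin k ⊕ Fin (k + 2) ⊕ Fin (l + 1) → Fin (k + 1) ⊕ Fin l :=
  Sum.elim (fun i => Sum.inl i.castSucc)
    (Sum.elim (Fin.lastCases (Sum.inl (Fin.last k)) fun i => Sum.inl i)
      (Fin.lastCases (Sum.inl (Fin.last k)) fun j => Sum.inr j))

/-- The identity strands only prolong vertices of `p`, and the cup followed by the last strand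
prolongs its last bottom vertex to the new last top vertex. Contracting these prolongations leaves
`p`. -/
theorem stack_unbend (p : Partition (k + 1) l) :
    stack (B := Fin (k + 2)) (p.tensor (⊤ : Partition 1 1))
      (Partition.tensor (idSetoid (Fin k)) (⊤ : Partition 0 2)) =
      p.comap (unbendContract k l) := by
  have e4 : ∀ (n : ℕ) (i : Fin 1), Fin.natAdd n i = Fin.last n := by
    intro n i
    ext
    simp
  have hc : ∀ i : Fin (k + 1), unbendContract k l (Sum.inr (Sum.inl i.castSucc)) = Sum.inl i := by
    intro i
    simp [unbendContract]
  have hl : unbendContract k l (Sum.inr (Sum.inl (Fin.last (k + 1)))) = Sum.inl (Fin.last k) := by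
    simp [unbendContract]
  have hc' : ∀ j : Fin l, unbendContract k l (Sum.inr (Sum.inr j.castSucc)) = Sum.inr j := by
    intro i
    simp [unbendContract]
  have hl' : unbendContract k l (Sum.inr (Sum.inr (Fin.last l))) = Sum.inl (Fin.last k) := by
    simp [unbendContract]
  -- The cup joins the last two middle vertices: the last bottom vertex of `p` and the foot of the
  -- added strand.
  have hmid : stack (B := Fin (k + 2)) (p.tensor (⊤ : Partition 1 1))
      (Partition.tensor (idSetoid (Fin k)) (⊤ : Partition 0 2))
      (Sum.inr (Sum.inl (Fin.last (k + 1)))) (Sum.inr (Sum.inl (Fin.last k).castSucc)) :=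
    glue_of_eq_left (Sum.inr (Fin.last (k + 1))) (Sum.inr (Fin.last k).castSucc)
      (tensor_of_right (Sum.inr 1) (Sum.inr 0) trivial rfl rfl) rfl rfl
  refine stack_eq_comap (unbendContract k l)
    -- The section places `p` where it sits in the stack: its bottom row in the middle row, its top
    -- row in the outer top row.
    (Sum.elim (fun i => Sum.inr (Sum.inl i.castSucc)) (fun j => Sum.inr (Sum.inr j.castSucc)))
    p ?_ ?_ ?_ ?_
  · have hL : ∀ x : Fin k ⊕ Fin k, unbendContract k l (Sum.map id Sum.inl (left 0 2 x)) =
        Sum.inl (Sum.elim id id x).castSucc := by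
      rintro (x | x)
      · rfl
      · exact hc x.castSucc
    have hR : ∀ x : Fin 0 ⊕ Fin 2, unbendContract k l (Sum.map id Sum.inl (right k k x)) =
        Sum.inl (Fin.last k) := by
      rintro (x | x)
      · exact x.elim0
      · fin_cases x
        · exact hc (Fin.last k)
        · exact hl
    intro a b h
    rcases left_or_right (k := k) (l := k) (k' := 0) (l' := 2) a with ⟨a, rfl⟩ | ⟨a, rfl⟩ <;>
      rcases left_or_right (k := k) (l := k) (k' := 0) (l' := 2) b with ⟨b, rfl⟩ | ⟨b, rfl⟩
    · rw [tensor_left_left] at h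
      have h' : Sum.elim id id a = Sum.elim id id b := h
      rw [hL, hL, h']
    · exact absurd h not_tensor_left_right
    · exact absurd h not_tensor_right_left
    · rw [hR, hR]
  · have hL : ∀ x : Fin (k + 1) ⊕ Fin l, unbendContract k l (Sum.inr (left 1 1 x)) = x := by
      rintro (x | x)
      · exact hc x
      · exact hc' x
    have hR : ∀ x : Fin 1 ⊕ Fin 1, unbendContract k l (Sum.inr (right (k + 1) l x)) =
        Sum.inl (Fin.last k) := by
      rintro (x | x) <;> simp only [right, Sum.map_inl, Sum.map_inr, e4]
      · exact hl
      · exact hl'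
    intro a b h
    rcases left_or_right (k := k + 1) (l := l) (k' := 1) (l' := 1) a with ⟨a, rfl⟩ | ⟨a, rfl⟩ <;>
      rcases left_or_right (k := k + 1) (l := l) (k' := 1) (l' := 1) b with ⟨b, rfl⟩ | ⟨b, rfl⟩
    · rw [tensor_left_left] at h
      rwa [hL, hL]
    · exact absurd h not_tensor_left_right
    · exact absurd h not_tensor_right_left
    · rw [hR, hR]
  · rintro (i | i | j)
    · exact glue_of_eq_left (Sum.inl i) (Sum.inr i.castSucc.castSucc)
        (tensor_of_left (Sum.inl i) (Sum.inr i) rfl rfl rfl) rfl rfl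
    · induction i using Fin.lastCases with
      | last =>
        rw [hl]
        exact hmid
      | cast i =>
        rw [hc]
        exact Setoid.refl' _ _
    · induction j using Fin.lastCases with
      | last =>
        rw [hl']
        refine Setoid.trans' _ ?_ hmid
        exact glue_of_eq_right (Sum.inr (Fin.last l)) (Sum.inl (Fin.last (k + 1)))
          (tensor_of_right (Sum.inr 0) (Sum.inl 0) trivial rfl rfl) rfl rfl
      | cast j =>
        rw [hc']
        exact Setoid.refl' _ _
  · intro x y h
    have hL : ∀ x : Fin (k + 1) ⊕ Fin l,
        Sum.elim (fun i => Sum.inr (Sum.inl i.castSucc)) (fun j => Sum.inr (Sum.inr j.castSucc)) x =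
          (Sum.inr (left 1 1 x) : Fin k ⊕ Fin (k + 2) ⊕ Fin (l + 1)) := by
      rintro (x | x) <;> rfl
    rw [hL, hL]
    exact glue_right _ _ _ (tensor_left_left.2 h)

theorem unbendContract_outer (x : Fin k ⊕ Fin (l + 1)) :
    unbendContract k l (Sum.map id Sum.inr x) = bendEquiv k l x := by
  rcases x with x | x <;> rfl

end Partition

/-! ### The functor commutes with bending -/

namespace Motzkin

theorem toPar_whisker {k l : ℕ} (f : (⟨k⟩ : Motzkin t) ⟶ ⟨l⟩) :
    toPar t _ _ (Presented.whisker f) =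
      Par.tensor (toPar t k l f) (Finsupp.single (⊤ : Partition 1 1) 1) := by
  have h := (isDiagramFunctor_toPar t).map_tensor f (𝟙 (⟨1⟩ : Motzkin t))
  rw [(isDiagramFunctor_toPar t).map_id] at h
  refine Eq.trans h ?_
  rw [← idSetoid_one]
  rfl

theorem toPar_cup (k : ℕ) : toPar t _ _ (cup t k) =
    Finsupp.single (Partition.tensor (idSetoid (Fin k)) (⊤ : Partition 0 2)) 1 := by
  refine Eq.trans (Par.tensor_single (t := t) (idSetoid (Fin k)) (⊤ : Partition 0 2) 1 1) ?_
  rw [mul_one]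

theorem toPar_unbend {k l : ℕ} (f : (⟨k + 1⟩ : Motzkin t) ⟶ ⟨l⟩) :
    toPar t _ _ (unbend f) = Finsupp.mapDomain (Partition.unbend k l) (toPar t _ _ f) := by
  have h := (isDiagramFunctor_toPar t).map_comp (cup t k) (Presented.whisker f)
  rw [toPar_whisker, toPar_cup] at h
  refine Eq.trans h ?_
  change Par.compBilin (⟨k⟩ : Par t) ⟨k + 2⟩ ⟨l + 1⟩ _ _ = _
  generalize toPar t (k + 1) l f = g
  induction g using Finsupp.induction_linear with
  | zero => simp
  | add g₁ g₂ h₁ h₂ =>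
    have e := Finsupp.mapDomain_add (f := Partition.unbend k l) (v₁ := g₁) (v₂ := g₂)
    rw [map_add, LinearMap.add_apply, map_add, LinearMap.add_apply, h₁, h₂]
    exact e.symm
  | single p a =>
    have h1 : star (B := Fin (k + 2)) (p.tensor (⊤ : Partition 1 1))
        (Partition.tensor (idSetoid (Fin k)) (⊤ : Partition 0 2)) = Partition.unbend k l p := by
      ext x y
      rw [star, Partition.stack_unbend, Setoid.comap_rel, Setoid.comap_rel,
        Partition.unbendContract_outer, Partition.unbendContract_outer, Partition.unbend_rel]
      rfl
    have h2 : middleCount (B := Fin (k + 2)) (p.tensor (⊤ : Partition 1 1))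
        (Partition.tensor (idSetoid (Fin k)) (⊤ : Partition 0 2)) = 0 := by
      refine middleCount_eq_zero fun b => ?_
      -- A middle vertex contracts to a bottom vertex of `p`, and every vertex of `p` is the
      -- contraction of an outer vertex. Hence no component is closed.
      obtain ⟨i, hi⟩ : ∃ i, Partition.unbendContract k l (Sum.inr (Sum.inl b)) = Sum.inl i := by
        induction b using Fin.lastCases <;> simp [Partition.unbendContract]
      refine ⟨(Partition.bendEquiv k l).symm (Sum.inl i), ?_⟩
      rw [Partition.stack_unbend, Setoid.comap_rel, Partition.unbendContract_outer, hi,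
        Equiv.apply_symm_apply]
    rw [Par.tensor_single, Par.compBilin_single, h1, h2]
    refine Eq.trans ?_ Finsupp.mapDomain_single.symm
    rw [mul_one, mul_one, pow_zero, mul_one]

/-- Formal from `toPar_unbend`, since bending and unbending are mutually inverse on both sides. -/
theorem toPar_bend {k l : ℕ} (f : (⟨k⟩ : Motzkin t) ⟶ ⟨l + 1⟩) :
    toPar t _ _ (bend f) = Finsupp.mapDomain (Partition.unbend k l).symm (toPar t _ _ f) := by
  have h := toPar_unbend (bend f)
  rw [unbend_bend] at h
  rw [h, ← Finsupp.mapDomain_comp, Equiv.symm_comp_self, Finsupp.mapDomain_id]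

theorem toPar_counitDot_comp {k l : ℕ} (f : (⟨k⟩ : Motzkin t) ⟶ ⟨l⟩) :
    toPar t _ _ (counitDot t k ≫ f) =
      Par.tensor (toPar t k l f) (Finsupp.single (⊤ : Partition 1 0) 1) := by
  rw [← tensor_counit]
  exact (isDiagramFunctor_toPar t).map_tensor f (gen t MotzkinGen.ε)

end Motzkin

/-- The partition of a Motzkin path. -/
@[reducible]
def MotzkinPath.diagram : ∀ {k j : ℕ}, MotzkinPath k j → Partition k j
  | _, _, nil => ⊤
  | _, _, level w => w.diagram.tensor (⊤ : Partition 1 0)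
  | _, _, up w => w.diagram.tensor (⊤ : Partition 1 1)
  | _, _, down w => (Partition.unbend _ _).symm w.diagram

theorem MotzkinPath.toPar_epi {k j : ℕ} (w : MotzkinPath k j) :
    Motzkin.toPar t k j (w.epi t) = Par.ofPartition t w.diagram := by
  induction w with
  | nil =>
    have h : idSetoid (Fin 0) = ⊤ := by
      ext x
      exact isEmptyElim x
    refine Eq.trans ((Motzkin.isDiagramFunctor_toPar t).map_id 0) ?_
    change Finsupp.single (idSetoid (Fin 0)) 1 = Finsupp.single ⊤ 1
    rw [h]
  | level w ih =>
    rw [epi, Motzkin.toPar_counitDot_comp, ih]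
    refine (Par.tensor_single _ _ _ _).trans ?_
    rw [mul_one]
    rfl
  | up w ih =>
    rw [epi, Motzkin.toPar_whisker, ih]
    refine (Par.tensor_single _ _ _ _).trans ?_
    rw [mul_one]
    rfl
  | down w ih =>
    rw [epi, ← Motzkin.bend, Motzkin.toPar_bend, ih]
    exact Finsupp.mapDomain_single

/-! ### Motzkin diagrams and Motzkin paths -/

/-- A form without cardinalities, convenient for relabellings and juxtapositions. -/
theorem isRookBrauer_iff {k l : ℕ} {p : Partition k l} :
    IsRookBrauer p ↔ ∀ a b c, p a b → p a c → a = b ∨ a = c ∨ b = c := by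
  constructor
  · intro h a b c hab hac
    by_contra! hne
    have h2 := h {x | p x a} ⟨a, rfl⟩
    have h3 : 2 < {x | p x a}.ncard := by
      rw [Set.two_lt_ncard (Set.toFinite _)]
      exact ⟨a, p.refl a, b, p.symm hab, c, p.symm hac, hne.1, hne.2.1, hne.2.2⟩
    omega
  · rintro h _ ⟨v, rfl⟩
    by_contra! h3
    rw [Set.two_lt_ncard (Set.toFinite _)] at h3
    obtain ⟨a, ha, b, hb, c, hc, hab, hac, hbc⟩ := h3
    rcases h a b c (p.trans ha (p.symm hb)) (p.trans ha (p.symm hc)) with h | h | h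
    · exact hab h
    · exact hac h
    · exact hbc h

theorem IsRookBrauer.comap {k l k' l' : ℕ} {p : Partition k l} (hp : IsRookBrauer p)
    {e : Fin k' ⊕ Fin l' → Fin k ⊕ Fin l} (he : Function.Injective e) :
    IsRookBrauer (p.comap e) := by
  rw [isRookBrauer_iff] at hp ⊢
  intro a b c hab hac
  simpa only [he.eq_iff] using hp _ _ _ hab hac

theorem IsPlanar.comap {k l k' l' : ℕ} {p : Partition k l} (hp : IsPlanar p)
    {e : Fin k' ⊕ Fin l' → Fin k ⊕ Fin l}
    (he : ∀ x y, boundaryPos x < boundaryPos y → boundaryPos (e x) < boundaryPos (e y)) :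
    IsPlanar (p.comap e) :=
  fun _ _ _ _ hab hbc hcd hac hbd => hp _ _ _ _ (he _ _ hab) (he _ _ hbc) (he _ _ hcd) hac hbd

/-- The last top vertex follows the last bottom vertex on the boundary, so moving it to the bottom
row changes no position. Hence bending preserves planarity. -/
theorem boundaryPos_bendEquiv {k l : ℕ} (x : Fin k ⊕ Fin (l + 1)) :
    boundaryPos (Partition.bendEquiv k l x) = boundaryPos x := by
  rcases x with i | j
  · rfl
  · induction j using Fin.lastCases with
    | last => simp [boundaryPos]
    | cast j =>
      simp only [Partition.bendEquiv_inr_castSucc, boundaryPos, Fin.val_rev, Fin.val_castSucc]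
      omega

namespace Partition

variable {k l k' l' : ℕ}

theorem left_injective : Function.Injective (left k' l' : Fin k ⊕ Fin l → _) := fun x y h => by
  simpa using congrArg (splitEquiv k l k' l') h

theorem left_ne_right (x : Fin k ⊕ Fin l) (y : Fin k' ⊕ Fin l') :
    left k' l' x ≠ right k l y := fun h => by
  simpa using congrArg (splitEquiv k l k' l') h

theorem boundaryPos_left (x : Fin k ⊕ Fin l) :
    boundaryPos x < k ∧ boundaryPos (left k' l' x) = boundaryPos x ∨
      k ≤ boundaryPos x ∧ boundaryPos (left k' l' x) = boundaryPos x + (k' + l') := by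
  rcases x with i | j
  · exact Or.inl ⟨i.isLt, rfl⟩
  · simp only [left, Sum.map_inr, boundaryPos, Fin.val_castAdd, Fin.val_rev]
    omega

theorem boundaryPos_right (x : Fin k' ⊕ Fin l') :
    boundaryPos (right k l x) = k + boundaryPos x ∧ boundaryPos x < k' + l' := by
  rcases x with i | j
  · exact ⟨rfl, i.isLt.trans_le (Nat.le_add_right _ _)⟩
  · simp only [right, Sum.map_inr, boundaryPos, Fin.val_natAdd, Fin.val_rev]
    omega

theorem boundaryPos_left_lt {x y : Fin k ⊕ Fin l} :
    boundaryPos (left k' l' x) < boundaryPos (left k' l' y) ↔ boundaryPos x < boundaryPos y := by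
  have hx := boundaryPos_left (k' := k') (l' := l') x
  have hy := boundaryPos_left (k' := k') (l' := l') y
  omega

theorem isRookBrauer_tensor {p : Partition k l} {q : Partition k' l'} (hp : IsRookBrauer p)
    (hq : IsRookBrauer q) : IsRookBrauer (p.tensor q) := by
  rw [isRookBrauer_iff] at hp hq ⊢
  intro a b c hab hac
  rcases left_or_right a with ⟨a, rfl⟩ | ⟨a, rfl⟩ <;>
    rcases left_or_right b with ⟨b, rfl⟩ | ⟨b, rfl⟩ <;>
    rcases left_or_right c with ⟨c, rfl⟩ | ⟨c, rfl⟩ <;>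
    simp only [tensor_left_left, tensor_right_right, not_tensor_left_right,
      not_tensor_right_left] at hab hac
  · rcases hp _ _ _ hab hac with rfl | rfl | rfl <;> simp
  · rcases hq _ _ _ hab hac with rfl | rfl | rfl <;> simp

/-- The right part occupies an interval of boundary positions, so blocks of different parts cannot
alternate; within one part the order is unchanged. -/
theorem isPlanar_tensor {p : Partition k l} {q : Partition k' l'} (hp : IsPlanar p)
    (hq : IsPlanar q) : IsPlanar (p.tensor q) := by
  intro a b c d hab hbc hcd hac hbd
  rcases left_or_right a with ⟨a, rfl⟩ | ⟨a, rfl⟩ <;>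
    rcases left_or_right b with ⟨b, rfl⟩ | ⟨b, rfl⟩ <;>
    rcases left_or_right c with ⟨c, rfl⟩ | ⟨c, rfl⟩ <;>
    rcases left_or_right d with ⟨d, rfl⟩ | ⟨d, rfl⟩ <;>
    simp only [tensor_left_left, tensor_right_right, not_tensor_left_right,
      not_tensor_right_left] at hac hbd ⊢
  · simp only [boundaryPos_left_lt] at hab hbc hcd
    exact hp _ _ _ _ hab hbc hcd hac hbd
  · have h1 := boundaryPos_left (k' := k') (l' := l') a
    have h2 := boundaryPos_right (k := k) (l := l) b
    have h3 := boundaryPos_left (k' := k') (l' := l') c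
    have h4 := boundaryPos_right (k := k) (l := l) d
    omega
  · have h1 := boundaryPos_right (k := k) (l := l) a
    have h2 := boundaryPos_left (k' := k') (l' := l') b
    have h3 := boundaryPos_right (k := k) (l := l) c
    have h4 := boundaryPos_left (k' := k') (l' := l') d
    omega
  · have h1 := boundaryPos_right (k := k) (l := l) a
    have h2 := boundaryPos_right (k := k) (l := l) b
    have h3 := boundaryPos_right (k := k) (l := l) c
    have h4 := boundaryPos_right (k := k) (l := l) d
    exact hq a b c d (by omega) (by omega) (by omega) hac hbd

theorem tensor_injective {p p' : Partition k l} {q : Partition k' l'}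
    (h : p.tensor q = p'.tensor q) : p = p' := by
  ext x y
  rw [← tensor_left_left (q := q), h, tensor_left_left]

/-- Used to split off the block of the last bottom vertex, which is a singleton or a vertical
strand. -/
theorem eq_tensor_top {p : Partition (k + k') (l + l')}
    (h1 : ∀ x y : Fin k' ⊕ Fin l', p (right k l x) (right k l y))
    (h2 : ∀ (x : Fin k ⊕ Fin l) (y : Fin k' ⊕ Fin l'), ¬ p (left k' l' x) (right k l y)) :
    Partition.tensor (p.comap (left k' l')) (⊤ : Partition k' l') = p := by
  ext x y
  rcases left_or_right x with ⟨x, rfl⟩ | ⟨x, rfl⟩ <;>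
    rcases left_or_right y with ⟨y, rfl⟩ | ⟨y, rfl⟩
  · rw [tensor_left_left, Setoid.comap_rel]
  · exact iff_of_false not_tensor_left_right (h2 x y)
  · exact iff_of_false not_tensor_right_left fun h => h2 y x (p.symm h)
  · exact iff_of_true (tensor_right_right.2 trivial) (h1 x y)

/-- Every top vertex is joined to a bottom vertex. -/
def TopsAttached (p : Partition k l) : Prop := ∀ j, ∃ i, p (Sum.inr j) (Sum.inl i)

end Partition

theorem isRookBrauer_top {k l : ℕ} (h : k + l ≤ 2) : IsRookBrauer (⊤ : Partition k l) := by
  intro B _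
  calc B.ncard ≤ Nat.card (Fin k ⊕ Fin l) := Set.ncard_le_card B
    _ = k + l := by simp
    _ ≤ 2 := h

theorem isPlanar_top {k l : ℕ} : IsPlanar (⊤ : Partition k l) := fun _ _ _ _ _ _ _ _ _ => trivial

theorem isRookBrauer_unbend {k l : ℕ} {p : Partition (k + 1) l} (hp : IsRookBrauer p) :
    IsRookBrauer (Partition.unbend k l p) :=
  hp.comap (Partition.bendEquiv k l).injective

theorem isPlanar_unbend {k l : ℕ} {p : Partition (k + 1) l} (hp : IsPlanar p) :
    IsPlanar (Partition.unbend k l p) :=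
  hp.comap fun x y h => by rwa [boundaryPos_bendEquiv, boundaryPos_bendEquiv]

theorem isRookBrauer_unbend_symm {k l : ℕ} {p : Partition k (l + 1)} (hp : IsRookBrauer p) :
    IsRookBrauer ((Partition.unbend k l).symm p) :=
  hp.comap (Partition.bendEquiv k l).symm.injective

theorem isPlanar_unbend_symm {k l : ℕ} {p : Partition k (l + 1)} (hp : IsPlanar p) :
    IsPlanar ((Partition.unbend k l).symm p) :=
  hp.comap fun x y h => by
    rwa [← boundaryPos_bendEquiv, ← boundaryPos_bendEquiv, Equiv.apply_symm_apply,
      Equiv.apply_symm_apply]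

/-! ### Paths as Motzkin diagrams with all top vertices attached -/

namespace MotzkinPath

open MotzkinCat.Partition

theorem isRookBrauer_diagram {k j : ℕ} (w : MotzkinPath k j) : IsRookBrauer w.diagram := by
  induction w with
  | nil => exact isRookBrauer_top (by omega)
  | level w ih => exact isRookBrauer_tensor ih (isRookBrauer_top (by omega))
  | up w ih => exact isRookBrauer_tensor ih (isRookBrauer_top (by omega))
  | down w ih => exact isRookBrauer_unbend_symm ih

theorem isPlanar_diagram {k j : ℕ} (w : MotzkinPath k j) : IsPlanar w.diagram := by
  induction w with
  | nil => exact isPlanar_top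
  | level w ih => exact isPlanar_tensor ih isPlanar_top
  | up w ih => exact isPlanar_tensor ih isPlanar_top
  | down w ih => exact isPlanar_unbend_symm ih

theorem topsAttached_diagram {k j : ℕ} (w : MotzkinPath k j) : TopsAttached w.diagram := by
  induction w with
  | nil => exact fun j => j.elim0
  | level w ih =>
    intro j
    obtain ⟨i, hi⟩ := ih j
    exact ⟨i.castSucc, tensor_of_left (Sum.inr j) (Sum.inl i) hi rfl rfl⟩
  | up w ih =>
    intro j
    induction j using Fin.lastCases with
    | last => exact ⟨Fin.last _, tensor_of_right (Sum.inr 0) (Sum.inl 0) trivial rfl rfl⟩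
    | cast j =>
      obtain ⟨i, hi⟩ := ih j
      exact ⟨i.castSucc, tensor_of_left (Sum.inr j) (Sum.inl i) hi rfl rfl⟩
  | down w ih =>
    intro j
    obtain ⟨i, hi⟩ := ih j.castSucc
    refine ⟨i.castSucc, ?_⟩
    rw [diagram, unbend_symm_rel]
    rwa [← bendEquiv_inl, ← bendEquiv_inr_castSucc, Equiv.symm_apply_apply, Equiv.symm_apply_apply]

theorem exists_rel_last_down {k j : ℕ} (w : MotzkinPath k (j + 1)) :
    ∃ i : Fin k, w.down.diagram (Sum.inl i.castSucc) (Sum.inl (Fin.last k)) := by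
  obtain ⟨i, hi⟩ := topsAttached_diagram w (Fin.last j)
  refine ⟨i, ?_⟩
  rw [diagram, unbend_symm_rel]
  rw [← bendEquiv_inl, ← bendEquiv_inr_last, Equiv.symm_apply_apply, Equiv.symm_apply_apply]
  exact Setoid.symm' _ hi

theorem not_rel_last_level {k j : ℕ} (w : MotzkinPath k j) (x : Fin k ⊕ Fin j) :
    ¬ w.level.diagram (left 1 0 x) (Sum.inl (Fin.last k)) :=
  not_tensor_left_right (p := w.diagram) (q := (⊤ : Partition 1 0)) (x := x) (y := Sum.inl 0)

theorem not_rel_last_up {k j : ℕ} (w : MotzkinPath k j) (x : Fin k ⊕ Fin j) :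
    ¬ w.up.diagram (left 1 1 x) (Sum.inl (Fin.last k)) :=
  not_tensor_left_right (p := w.diagram) (q := (⊤ : Partition 1 1)) (x := x) (y := Sum.inl 0)

theorem rel_last_up {k j : ℕ} (w : MotzkinPath k j) :
    w.up.diagram (Sum.inr (Fin.last j)) (Sum.inl (Fin.last k)) :=
  tensor_of_right (Sum.inr 0) (Sum.inl 0) trivial rfl rfl

/-- The last step is read off from the block of the last bottom vertex: it is alone for a level
step, joined to the last top vertex for an up step, and joined to another bottom vertex for a down
step. Removing the step is injective on diagrams. -/
theorem diagram_injective {k j : ℕ} {w v : MotzkinPath k j} (h : w.diagram = v.diagram) :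
    w = v := by
  induction w with
  | nil =>
    cases v
    rfl
  | level w ih =>
    cases v with
    | level v => rw [ih (tensor_injective h)]
    | up v =>
      have h' := rel_last_up v
      rw [← h] at h'
      exact absurd h' (not_rel_last_level w (Sum.inr (Fin.last _)))
    | down v =>
      obtain ⟨i, hi⟩ := exists_rel_last_down v
      rw [← h] at hi
      exact absurd hi (not_rel_last_level w (Sum.inl i))
  | up w ih =>
    cases v with
    | level v =>
      have h' := rel_last_up w
      rw [h] at h'
      exact absurd h' (not_rel_last_level v (Sum.inr (Fin.last _)))
    | up v => rw [ih (tensor_injective h)]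
    | down v =>
      obtain ⟨i, hi⟩ := exists_rel_last_down v
      rw [← h] at hi
      exact absurd hi (not_rel_last_up w (Sum.inl i))
  | down w ih =>
    obtain ⟨i, hi⟩ := exists_rel_last_down w
    rw [h] at hi
    cases v with
    | level v => exact absurd hi (not_rel_last_level v (Sum.inl i))
    | up v => exact absurd hi (not_rel_last_up v (Sum.inl i))
    | down v => rw [ih ((unbend _ _).symm.injective h)]

/-- Induction on the bottom vertices, with the last step dictated by the partner of the last one:
none, a bottom vertex, or a top vertex. In the second case that vertex is bent up, and it remains
attached to its partner. -/
theorem exists_diagram_eq {k : ℕ} : ∀ {j : ℕ} (p : Partition k j), IsRookBrauer p → IsPlanar p →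
    TopsAttached p → ∃ w : MotzkinPath k j, w.diagram = p := by
  induction k with
  | zero =>
    intro j p _ _ ha
    cases j with
    | zero =>
      refine ⟨nil, ?_⟩
      ext x
      exact isEmptyElim x
    | succ j => exact (ha 0).choose.elim0
  | succ k ih =>
    intro j p hrb hpl ha
    have hrb' := isRookBrauer_iff.1 hrb
    by_cases hdot : ∀ u, p u (Sum.inl (Fin.last k)) → u = Sum.inl (Fin.last k)
    · have hr : ∀ y : Fin 1 ⊕ Fin 0, right k j y = Sum.inl (Fin.last k) := by
        rintro (y | y)
        · rw [Subsingleton.elim y 0]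
          rfl
        · exact y.elim0
      have hp : Partition.tensor (p.comap (left 1 0)) (⊤ : Partition 1 0) = p := by
        refine eq_tensor_top (k' := 1) (l' := 0) ?_ ?_
        · intro x y
          rw [hr, hr]
        · intro x y h
          rw [hr] at h
          exact left_ne_right x (Sum.inl 0) (hdot _ h)
      obtain ⟨w, hw⟩ := ih (p.comap (left 1 0)) (hrb.comap left_injective)
        (hpl.comap fun x y h => boundaryPos_left_lt.2 h) (by
          intro i
          obtain ⟨i', hi'⟩ := ha i
          induction i' using Fin.lastCases with
          | last => cases hdot _ hi'
          | cast i' => exact ⟨i', hi'⟩)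
      refine ⟨w.level, ?_⟩
      rw [diagram, hw]
      exact hp
    · push Not at hdot
      obtain ⟨u, hu, hne⟩ := hdot
      have huniq : ∀ x, p x (Sum.inl (Fin.last k)) → x = Sum.inl (Fin.last k) ∨ x = u := by
        intro x hx
        rcases hrb' _ _ _ (p.symm hx) (p.symm hu) with h | h | h
        · exact Or.inl h.symm
        · exact absurd h.symm hne
        · exact Or.inr h
      rcases u with i | i
      · obtain ⟨i, rfl⟩ : ∃ i', i = Fin.castSucc i' := by
          induction i using Fin.lastCases with
          | last => exact absurd rfl hne
          | cast i => exact ⟨i, rfl⟩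
        obtain ⟨w, hw⟩ := ih (unbend k j p) (isRookBrauer_unbend hrb) (isPlanar_unbend hpl) (by
          intro y
          induction y using Fin.lastCases with
          | last =>
            refine ⟨i, ?_⟩
            rw [unbend_rel, bendEquiv_inr_last, bendEquiv_inl]
            exact p.symm hu
          | cast y =>
            obtain ⟨i', hi'⟩ := ha y
            induction i' using Fin.lastCases with
            | last => 
              rcases huniq _ hi' with h | h <;> cases h
            | cast i' =>
              refine ⟨i', ?_⟩
              rwa [unbend_rel, bendEquiv_inr_castSucc, bendEquiv_inl])
        refine ⟨w.down, ?_⟩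
        rw [diagram, hw, Equiv.symm_apply_apply]
      · cases j with
        | zero => exact i.elim0
        | succ j =>
        -- If the partner were another top vertex `i`, the bottom vertex attached to the last top
        -- vertex would lie to the left of the last bottom vertex. The two strands would then cross.
        obtain rfl : i = Fin.last j := by
          by_contra hi
          obtain ⟨m, hm⟩ := ha (Fin.last j)
          have hlt : i < Fin.last j := Fin.lt_last_iff_ne_last.2 hi
          induction m using Fin.lastCases with
          | last =>
            rcases huniq _ hm with h | h
            · cases h
            · exact hi (Sum.inr_injective h).symm
          | cast m =>
            have h := hpl (Sum.inl m.castSucc) (Sum.inl (Fin.last k)) (Sum.inr (Fin.last j))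
              (Sum.inr i) (by simp [boundaryPos]) (by simp [boundaryPos])
              (by
                have hlt' : (i : ℕ) < j := hlt
                simp only [boundaryPos, Fin.val_rev, Fin.val_last]
                omega)
              (p.symm hm) (p.symm hu)
            rcases huniq _ h with h | h
            · have := congrArg Fin.val (Sum.inl_injective h)
              simp only [Fin.val_castSucc, Fin.val_last] at this
              omega
            · cases h
        have hr : ∀ y : Fin 1 ⊕ Fin 1, p (right k j y) (Sum.inl (Fin.last k)) := by
          rintro (y | y)
          · rw [Subsingleton.elim y 0]
            exact p.refl _
          · rw [Subsingleton.elim y 0]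
            exact hu
        have hl : ∀ x : Fin k ⊕ Fin j, ¬ p (left 1 1 x) (Sum.inl (Fin.last k)) := by
          intro x h
          rcases huniq _ h with h | h
          · exact left_ne_right x (Sum.inl 0) h
          · exact left_ne_right x (Sum.inr 0) h
        have hp : Partition.tensor (p.comap (left 1 1)) (⊤ : Partition 1 1) = p :=
          eq_tensor_top (k' := 1) (l' := 1) (fun x y => p.trans (hr x) (p.symm (hr y)))
            fun x y h => hl x (p.trans h (hr y))
        obtain ⟨w, hw⟩ := ih (p.comap (left 1 1)) (hrb.comap left_injective)
          (hpl.comap fun x y h => boundaryPos_left_lt.2 h) (by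
            intro y
            obtain ⟨i', hi'⟩ := ha y.castSucc
            induction i' using Fin.lastCases with
            | last => exact absurd hi' (hl (Sum.inr y))
            | cast i' => exact ⟨i', hi'⟩)
        refine ⟨w.up, ?_⟩
        rw [diagram, hw]
        exact hp

end MotzkinPath

/-! ### The diagram basis -/

section Monomial

open Presented Motzkin

theorem isMonomial_cap (a : ℕ) : IsMonomial (cap t a) :=
  IsMonomial.tensor (.id a) (.of MotzkinGen.d)

theorem isMonomial_cup (a : ℕ) : IsMonomial (cup t a) :=
  IsMonomial.tensor (.id a) (.of MotzkinGen.c)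

theorem isMonomial_counitDot (a : ℕ) : IsMonomial (counitDot t a) :=
  IsMonomial.tensor (.id a) (.of MotzkinGen.ε)

theorem isMonomial_whisker {k l : ℕ} {f : (⟨k⟩ : Motzkin t) ⟶ ⟨l⟩} (hf : IsMonomial f) :
    IsMonomial (whisker f) :=
  IsMonomial.tensor hf (.id 1)

theorem isMonomial_unbend {k l : ℕ} {f : (⟨k + 1⟩ : Motzkin t) ⟶ ⟨l⟩} (hf : IsMonomial f) :
    IsMonomial (unbend f) :=
  IsMonomial.comp (isMonomial_whisker hf) (isMonomial_cup k)

theorem MotzkinPath.isMonomial_epi {k j : ℕ} (w : MotzkinPath k j) : IsMonomial (w.epi t) := by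
  induction w with
  | nil => exact .id 0
  | level w ih => exact .comp ih (isMonomial_counitDot _)
  | up w ih => exact isMonomial_whisker ih
  | down w ih => exact .comp (isMonomial_cap _) (isMonomial_whisker ih)

end Monomial

/-- Induction on `l` for all `k` at once, since unbending trades a bottom vertex for a top one. For
`l = 0` the condition on top vertices is vacuous, so all Motzkin diagrams come from paths. -/
theorem exists_spanning_family (t : 𝕜) (l : ℕ) : ∀ k : ℕ,
    ∃ b : MotzkinDiagram k l → ((⟨k⟩ : Motzkin t) ⟶ ⟨l⟩),
      (∀ D, Presented.IsMonomial (b D) ∧ Motzkin.toPar t k l (b D) = Par.ofPartition t D.1) ∧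
        Submodule.span 𝕜 (Set.range b) = ⊤ := by
  induction l with
  | zero =>
    intro k
    have hw : ∀ D : MotzkinDiagram k 0, ∃ w : MotzkinPath k 0, w.diagram = D.1 := fun D =>
      MotzkinPath.exists_diagram_eq D.1 D.2.1 D.2.2 fun j => j.elim0
    choose w hw using hw
    refine ⟨fun D => (w D).epi t, fun D => ⟨(w D).isMonomial_epi, ?_⟩, ?_⟩
    · rw [MotzkinPath.toPar_epi, hw]
    · rw [← MotzkinPath.epiSpan_zero, MotzkinPath.epiSpan]
      congr 1
      refine (Set.range_comp_subset_range w fun v => v.epi t).antisymm ?_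
      rintro _ ⟨v, rfl⟩
      refine ⟨⟨v.diagram, v.isRookBrauer_diagram, v.isPlanar_diagram⟩, ?_⟩
      -- The path chosen for the diagram of `v` is `v` itself, so the chosen paths exhaust all
      -- paths.
      have h := MotzkinPath.diagram_injective
        (hw ⟨v.diagram, v.isRookBrauer_diagram, v.isPlanar_diagram⟩)
      exact congrArg (fun v => v.epi t) h
  | succ l ih =>
    intro k
    obtain ⟨b, hb, hspan⟩ := ih (k + 1)
    let e : MotzkinDiagram k (l + 1) → MotzkinDiagram (k + 1) l := fun D =>
      ⟨(Partition.unbend k l).symm D.1, isRookBrauer_unbend_symm D.2.1,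
        isPlanar_unbend_symm D.2.2⟩
    have he : Function.Surjective e := fun D =>
      ⟨⟨Partition.unbend k l D.1, isRookBrauer_unbend D.2.1, isPlanar_unbend D.2.2⟩,
        Subtype.ext ((Partition.unbend k l).symm_apply_apply D.1)⟩
    refine ⟨fun D => Motzkin.unbend (b (e D)), fun D => ⟨isMonomial_unbend (hb _).1, ?_⟩, ?_⟩
    · rw [Motzkin.toPar_unbend, (hb _).2]
      refine Finsupp.mapDomain_single.trans ?_
      rw [Equiv.apply_symm_apply]
      rfl
    · have h : Set.range (fun D => Motzkin.unbend (b (e D))) =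
          Motzkin.unbend (t := t) '' Set.range b := by
        rw [← Set.range_comp, ← he.range_comp]
        rfl
      rw [h, ← Submodule.map_span, hspan, Submodule.map_top, LinearMap.range_eq_top]
      exact fun f => ⟨Motzkin.bend f, Motzkin.unbend_bend f⟩

theorem linearIndependent_ofPartition (t : 𝕜) (k l : ℕ) :
    LinearIndependent 𝕜 fun D : MotzkinDiagram k l => Par.ofPartition t D.1 :=
  (Finsupp.linearIndependent_single_one 𝕜 (Partition k l)).comp _ Subtype.val_injective

/-- Linear independence is pulled back along the functor from the partitions; spanning is
`exists_spanning_family`. -/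
theorem exists_basis (t : 𝕜) (k l : ℕ) :
    ∃ b : Module.Basis (MotzkinDiagram k l) 𝕜 ((⟨k⟩ : Motzkin t) ⟶ ⟨l⟩), ∀ D,
      Presented.IsMonomial (b D) ∧ Motzkin.toPar t k l (b D) = Par.ofPartition t D.1 := by
  obtain ⟨b, hb, hspan⟩ := exists_spanning_family t l k
  have hli : LinearIndependent 𝕜 b := by
    refine LinearIndependent.of_comp (Motzkin.toPar t k l) ?_
    have h : Motzkin.toPar t k l ∘ b = fun D => Par.ofPartition t D.1 := funext fun D => (hb D).2
    rw [h]
    exact linearIndependent_ofPartition t k l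
  refine ⟨Module.Basis.mk hli hspan.ge, fun D => ?_⟩
  rw [Module.Basis.mk_apply]
  exact hb D

theorem Motzkin.toPar_injective (t : 𝕜) (k l : ℕ) : Function.Injective (Motzkin.toPar t k l) := by
  obtain ⟨b, hb⟩ := exists_basis t k l
  have h : Motzkin.toPar t k l =
      b.constr 𝕜 fun D : MotzkinDiagram k l => Par.ofPartition t D.1 :=
    b.ext fun D => by rw [(hb D).2, Module.Basis.constr_basis]
  rw [h]
  exact b.injective_constr_of_linearIndependent (linearIndependent_ofPartition t k l)

/-- The functor to the partition category on an endomorphism algebra. -/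
noncomputable def Motzkin.toParEnd (t : 𝕜) (k : ℕ) :
    End (⟨k⟩ : Motzkin t) →ₐ[𝕜] PartitionAlgebra t k :=
  AlgHom.ofLinearMap (Motzkin.toPar t k k) ((Motzkin.isDiagramFunctor_toPar t).map_id k)
    -- The product `f * g` in `End` is `g ≫ f`, hence the reversed arguments.
    fun f g => (Motzkin.isDiagramFunctor_toPar t).map_comp g f

/-- The functor sends a basis to the Motzkin diagrams. Since the range of an algebra map is a
subalgebra, the Motzkin span is closed under multiplication without a check that stacking preserves
planarity. -/
theorem Motzkin.range_toParEnd (t : 𝕜) (k : ℕ) :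
    Subalgebra.toSubmodule (Motzkin.toParEnd t k).range = motzkinSpan t k := by
  obtain ⟨b, hb⟩ := exists_basis t k k
  have h : LinearMap.range (Motzkin.toPar t k k) = motzkinSpan t k := by
    rw [← Submodule.map_top, ← b.span_eq, Submodule.map_span, ← Set.range_comp]
    have h' : Motzkin.toPar t k k ∘ b = fun D => Par.ofPartition t D.1 := funext fun D => (hb D).2
    rw [h']
    rfl
  rw [← h]
  rfl

end MotzkinCat

theorem mainTheorem4 {𝕜 : Type u} [CommRing 𝕜] (t : 𝕜) :
    ∃ J : ∀ k l : ℕ,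
        ((⟨k⟩ : MotzkinCat.Motzkin t) ⟶ ⟨l⟩) →ₗ[𝕜] ((⟨k⟩ : MotzkinCat.Par t) ⟶ ⟨l⟩),
      MotzkinCat.IsDiagramFunctor t J ∧
      (∀ k l : ℕ,
        ∃ b : Module.Basis (MotzkinCat.MotzkinDiagram k l) 𝕜
            ((⟨k⟩ : MotzkinCat.Motzkin t) ⟶ ⟨l⟩),
          ∀ D : MotzkinCat.MotzkinDiagram k l,
            MotzkinCat.Presented.IsMonomial (b D) ∧
            J k l (b D) = MotzkinCat.Par.ofPartition t D.1) ∧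
      (∀ k : ℕ,
        ∃ M : Subalgebra 𝕜 (MotzkinCat.PartitionAlgebra t k),
          Subalgebra.toSubmodule M = MotzkinCat.motzkinSpan t k ∧
          ∃ e : End (⟨k⟩ : MotzkinCat.Motzkin t) ≃ₐ[𝕜] M,
            ∀ f : End (⟨k⟩ : MotzkinCat.Motzkin t),
              (e f : MotzkinCat.PartitionAlgebra t k) = J k k f) := by
  open MotzkinCat in
  refine ⟨Motzkin.toPar t, Motzkin.isDiagramFunctor_toPar t, exists_basis t, fun k => ?_⟩
  exact ⟨(Motzkin.toParEnd t k).range, Motzkin.range_toParEnd t k,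
    AlgEquiv.ofInjective (Motzkin.toParEnd t k) (Motzkin.toPar_injective t k k), fun f => rfl⟩
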